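/- Let $\mathbb F$ be an algebraically closed field of characteristic zero and let $\mathfrak g=\mathfrak g_{\bar 0}\oplus\mathfrak g_{\bar 1}$ be a Lie superalgebra over $\mathbb F$ which is two-step nilpotent, i.e. $[\mathfrak g,\mathfrak g]\neq 0$ and $[\mathfrak g,[\mathfrak g,\mathfrak g]]=0$. Let $|x|\in\mathbb Z/2$ denote the parity of a homogeneous element. For $M=\mathfrak g$ (the adjoint module) or $M=\mathbb F$ (the trivial module), let $M\otimes\bigwedge^n\mathfrak g^*$ be the space of $n$-cochains, that is, of $n$-linear maps $\varphi:\mathfrak g^n\to M$ such that interchanging two adjacent homogeneous arguments $x,y$ multiplies the value by $-(-1)^{|x||y|}$; here $(m\otimes w)(x_1,\dots,x_n)=w(x_1,\dots,x_n)\,m$. The differential $\mathrm d$ is given, for homogeneous $\varphi$ and homogeneous $x_0,\dots,x_n$, by $$(\mathrm d\varphi)(x_0,\dots,x_n)=\sum_{i}(-1)^{i+|x_i|(|\varphi|+|x_0|+\cdots+|x_{i-1}|)}\,x_i\cdot\varphi(x_0,\dots,\widehat{x_i},\dots,x_n)+\sum_{i<j}(-1)^{j+|x_j|(|x_{i+1}|+\cdots+|x_{j-1}|)}\,\varphi(x_0,\dots,x_{i-1},[x_i,x_j],x_{i+1},\dots,\widehat{x_j},\dots,x_n).$$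 With respect to a bilinear pairing $\star$, the cup product of a $q$-cochain $f$ and a homogeneous $p$-cochain $h$ is $$(f\cup h)(x_1,\dots,x_{p+q})=\frac1{p!\,q!}\sum_{\sigma\in S_{p+q}}(-1)^{(|x_{\sigma(1)}|+\cdots+|x_{\sigma(q)}|)|h|}\,\mathrm{sgn}(\sigma)\,\gamma(x,\sigma)\;f(x_{\sigma(1)},\dots,x_{\sigma(q)})\star h(x_{\sigma(q+1)},\dots,x_{\sigma(q+p)}),$$ where $\gamma(x,\sigma)=\prod_{i<j,\ \sigma(i)>\sigma(j)}(-1)^{|x_{\sigma(i)}||x_{\sigma(j)}|}$. For scalar-valued cochains with $\star$ the multiplication of $\mathbb F$ this is the product $\wedge$ of the super-exterior algebra $\bigwedge^\bullet\mathfrak g^*$; for $\mathfrak g$-valued cochains with $\star=[\cdot,\cdot]$ it induces the cup product on the adjoint cohomology $\mathrm H^\bullet(\mathfrak g,\mathfrak g)$. Let $V$ be any complement of the subspace $[\mathfrak g,\mathfrak g]$ in $\mathfrak g$. Through $\mathfrak g=[\mathfrak g,\mathfrak g]\oplus V$ identify $[\mathfrak g,\mathfrak g]^*$ with the linear forms on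 $\mathfrak g$ that vanish on $V$, and $\bigwedge^kV^*$ with the elements of $\bigwedge^k\mathfrak g^*$ that vanish whenever one argument lies in $[\mathfrak g,\mathfrak g]$. **Theorem.** Suppose that for every $k\ge 1$ the following two conditions hold: 1. $[\mathfrak g,\mathfrak g]\otimes\bigwedge^kV^*\subseteq\operatorname{Im}\mathrm d$, where $\mathrm d$ is the differential of $\mathfrak g\otimes\bigwedge^\bullet\mathfrak g^*$; 2. for all $f\in[\mathfrak g,\mathfrak g]^*$ and $w\in\bigwedge^kV^*$, if $\mathrm d(f)\wedge w=0$, then $f=0$ or $w=0$. Then the cup product on the adjoint cohomology $\mathrm H^\bullet(\mathfrak g,\mathfrak g)$ is trivial: for all $p,q\ge 0$ and all cocycles $f\in\mathfrak g\otimes\bigwedge^q\mathfrak g^*$ and $h\in\mathfrak g\otimes\bigwedge^p\mathfrak g^*$, the cocycle $f\cup h$ is a coboundary. -/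

import Mathlib

open scoped BigOperators

/-- A `ℤ/2`-graded vector space (superspace) `M = M₀ ⊕ M₁`. -/
class SuperSpace (K M : Type*) [Field K] [AddCommGroup M] [Module K M] where
  even : Submodule K M
  odd : Submodule K M
  isCompl : IsCompl even odd

namespace SuperSpace

/-- The ground field, as a superspace concentrated in even degree. -/
instance ground (K : Type*) [Field K] : SuperSpace K K where
  even := ⊤
  odd := ⊥
  isCompl := isCompl_top_bot

variable (K : Type*) {M : Type*} [Field K] [AddCommGroup M] [Module K M] [SuperSpace K M]

/-- The subspace of homogeneous elements of parity `a`. -/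
def part (a : ZMod 2) : Submodule K M :=
  if a = 0 then even else odd

/-- The projection of `M = M₀ ⊕ M₁` onto the homogeneous component of parity `a`. -/
noncomputable def proj (a : ZMod 2) : M →ₗ[K] M :=
  if a = 0 then Submodule.projection even odd isCompl else
    Submodule.projection odd even isCompl.symm

/-- The sign `(-1)^a` for `a ∈ ℤ/2`. -/
def sgn (a : ZMod 2) : K := (-1) ^ a.val

end SuperSpace

open SuperSpace in
/-- A Lie superalgebra over a field (of characteristic zero): a superspace with a bilinear bracket
which is even, skew-supersymmetric and satisfies the super Jacobi identity. -/
class LieSuperalgebra (K g : Type*) [Field K] [AddCommGroup g] [Module K g]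
    extends SuperSpace K g where
  bracket : g →ₗ[K] g →ₗ[K] g
  bracket_mem : ∀ (a b : ZMod 2) (x y : g), x ∈ part K a → y ∈ part K b →
    bracket x y ∈ part K (a + b)
  bracket_skew : ∀ (a b : ZMod 2) (x y : g), x ∈ part K a → y ∈ part K b →
    bracket x y = -(sgn K (a * b) • bracket y x)
  jacobi : ∀ (a b : ZMod 2) (x y z : g), x ∈ part K a → y ∈ part K b →
    bracket x (bracket y z) = bracket (bracket x y) z + sgn K (a * b) • bracket y (bracket x z)

namespace LieSuperalgebra

open SuperSpace

section LowerCentralSeries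

variable (K g : Type*) [Field K] [AddCommGroup g] [Module K g] [LieSuperalgebra K g]

/-- The lower central series `g⁰ = g`, `gⁱ⁺¹ = [g, gⁱ]` (linear span of the brackets). -/
def lcs : ℕ → Submodule K g
  | 0 => ⊤
  | i + 1 => Submodule.span K {z | ∃ x : g, ∃ y ∈ lcs i, bracket (K := K) x y = z}

/-- The derived subalgebra `[g, g]`. -/
def derived : Submodule K g :=
  Submodule.span K {z | ∃ x y : g, bracket (K := K) x y = z}

/-- `g` is `n`-step nilpotent: `gⁿ⁻¹ ≠ 0` and `gⁿ = 0` (where `n ≥ 1`). -/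
def IsStepNilpotent (n : ℕ) : Prop :=
  1 ≤ n ∧ lcs K g (n - 1) ≠ ⊥ ∧ lcs K g n = ⊥

end LowerCentralSeries

section Cochains

variable {K g M M₁ M₂ M₃ : Type*} [Field K] [AddCommGroup g] [Module K g]
  [AddCommGroup M] [Module K M] [AddCommGroup M₁] [Module K M₁]
  [AddCommGroup M₂] [Module K M₂] [AddCommGroup M₃] [Module K M₃]

/-- The multilinear map which coincides with `F ε` on the tuples of homogeneous elements with
parities `ε`. -/
noncomputable def ofHomogeneous [SuperSpace K g] {n : ℕ}
    (F : (Fin n → ZMod 2) → MultilinearMap K (fun _ : Fin n => g) M) :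
    MultilinearMap K (fun _ : Fin n => g) M :=
  ∑ ε : Fin n → ZMod 2, (F ε).compLinearMap (fun i => proj K (ε i))

/-- The component of parity `s` of a multilinear map `φ`: on homogeneous arguments it is the
component of the value of `φ` whose parity is `s` plus the sum of the parities of the arguments.
(If all values are scalars then this picks the arguments whose parities add up to `s`.) -/
noncomputable def parityPart [SuperSpace K g] [SuperSpace K M] {n : ℕ} (s : ZMod 2)
    (φ : MultilinearMap K (fun _ : Fin n => g) M) : MultilinearMap K (fun _ : Fin n => g) M :=
  ofHomogeneous fun ε => (proj K (s + ∑ i, ε i)).compMultilinearMap φ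

variable (K g M) in
/-- The space `M ⊗ ⋀ⁿ g*` of `n`-cochains, as the space of super-alternating `n`-linear maps
`gⁿ → M`: interchanging two adjacent homogeneous arguments `x, y` multiplies the value by
`-(-1)^(|x||y|)`. -/
def cochains [SuperSpace K g] (n : ℕ) : Submodule K (MultilinearMap K (fun _ : Fin n => g) M) where
  carrier := {φ | ∀ i j : Fin n, (i : ℕ) + 1 = j → ∀ (a b : ZMod 2) (x : Fin n → g),
    x i ∈ part K a → x j ∈ part K b →
      φ (fun l => x (Equiv.swap i j l)) = -(sgn K (a * b) • φ x)}
  zero_mem' := by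
    intro i j _ a b x _ _
    simp
  add_mem' := by
    intro φ ψ hφ hψ i j hij a b x hx hy
    rw [add_apply, add_apply, hφ i j hij a b x hx hy,
      hψ i j hij a b x hx hy, smul_add, neg_add]
  smul_mem' := by
    intro c φ hφ i j hij a b x hx hy
    rw [smul_apply, smul_apply, hφ i j hij a b x hx hy,
      smul_neg, smul_comm]

/-- A linear form, as a `1`-form. -/
def oneForm (f : Module.Dual K g) : MultilinearMap K (fun _ : Fin 1 => g) K :=
  MultilinearMap.ofSubsingleton K g K (0 : Fin 1) f

/-! ### The differential -/

/-- `(x₀, …, xₙ) ↦ xᵢ · φ(x₀, …, x̂ᵢ, …, xₙ)`, for a bilinear action `ρ` of `g` on `M`. -/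
def actionTerm {n : ℕ} (ρ : g →ₗ[K] M →ₗ[K] M) (i : Fin (n + 1))
    (φ : MultilinearMap K (fun _ : Fin n => g) M) :
    MultilinearMap K (fun _ : Fin (n + 1) => g) M :=
  MultilinearMap.mk' (fun x => ρ (x i) (φ (i.removeNth x)))
    (by
      intro x l u v
      rcases eq_or_ne l i with rfl | h
      · simp
      · obtain ⟨m, rfl⟩ := Fin.exists_succAbove_eq h
        simp [Fin.removeNth_update_succAbove])
    (by
      intro x l c u
      rcases eq_or_ne l i with rfl | h
      · simp
      · obtain ⟨m, rfl⟩ := Fin.exists_succAbove_eq h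
        simp [Fin.removeNth_update_succAbove])

/-- `(x₀, …, xₙ) ↦ φ(x₀, …, xᵢ₋₁, [xᵢ, xⱼ], xᵢ₊₁, …, x̂ⱼ, …, xₙ)`, for `i < j`. -/
def bracketTerm [LieSuperalgebra K g] {n : ℕ} (i j : Fin (n + 1)) (hij : i < j)
    (φ : MultilinearMap K (fun _ : Fin n => g) M) :
    MultilinearMap K (fun _ : Fin (n + 1) => g) M :=
  MultilinearMap.mk'
    (fun x => φ (j.removeNth (Function.update x i (bracket (K := K) (x i) (x j)))))
    (by
      intro x l u v
      obtain ⟨m, hm⟩ := Fin.exists_succAbove_eq hij.ne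
      subst hm
      rcases eq_or_ne l j with rfl | h
      · simp [Fin.removeNth_update_succAbove]
      · obtain ⟨l, rfl⟩ := Fin.exists_succAbove_eq h
        rcases eq_or_ne l m with rfl | h'
        · simp [Fin.removeNth_update_succAbove]
        · have h2 : j.succAbove m ≠ j.succAbove l := fun e =>
            h' (Fin.succAbove_right_injective e).symm
          simp [Fin.removeNth_update_succAbove, Function.update_of_ne h2, Function.update_comm h'])
    (by
      intro x l c u
      obtain ⟨m, hm⟩ := Fin.exists_succAbove_eq hij.ne
      subst hm
      rcases eq_or_ne l j with rfl | h
      · simp [Fin.removeNth_update_succAbove]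
      · obtain ⟨l, rfl⟩ := Fin.exists_succAbove_eq h
        rcases eq_or_ne l m with rfl | h'
        · simp [Fin.removeNth_update_succAbove]
        · have h2 : j.succAbove m ≠ j.succAbove l := fun e =>
            h' (Fin.succAbove_right_injective e).symm
          simp [Fin.removeNth_update_succAbove, Function.update_of_ne h2, Function.update_comm h'])

theorem ofHomogeneous_add [SuperSpace K g] {n : ℕ}
    (F G : (Fin n → ZMod 2) → MultilinearMap K (fun _ : Fin n => g) M) :
    ofHomogeneous (fun ε => F ε + G ε) = ofHomogeneous F + ofHomogeneous G := by
  ext x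
  simp [ofHomogeneous, Finset.sum_add_distrib]

theorem ofHomogeneous_smul [SuperSpace K g] {n : ℕ} (c : K)
    (F : (Fin n → ZMod 2) → MultilinearMap K (fun _ : Fin n => g) M) :
    ofHomogeneous (fun ε => c • F ε) = c • ofHomogeneous F := by
  ext x
  simp [ofHomogeneous, Finset.smul_sum]

theorem parityPart_add [SuperSpace K g] [SuperSpace K M] {n : ℕ} (s : ZMod 2)
    (φ ψ : MultilinearMap K (fun _ : Fin n => g) M) :
    parityPart s (φ + ψ) = parityPart s φ + parityPart s ψ := by
  ext x
  simp [parityPart, ofHomogeneous, Finset.sum_add_distrib]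

theorem parityPart_smul [SuperSpace K g] [SuperSpace K M] {n : ℕ} (s : ZMod 2) (c : K)
    (φ : MultilinearMap K (fun _ : Fin n => g) M) :
    parityPart s (c • φ) = c • parityPart s φ := by
  ext x
  simp [parityPart, ofHomogeneous, Finset.smul_sum]

theorem actionTerm_add {n : ℕ} (ρ : g →ₗ[K] M →ₗ[K] M) (i : Fin (n + 1))
    (φ ψ : MultilinearMap K (fun _ : Fin n => g) M) :
    actionTerm ρ i (φ + ψ) = actionTerm ρ i φ + actionTerm ρ i ψ := by
  ext x
  simp [actionTerm]

theorem actionTerm_smul {n : ℕ} (ρ : g →ₗ[K] M →ₗ[K] M) (i : Fin (n + 1)) (c : K)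
    (φ : MultilinearMap K (fun _ : Fin n => g) M) :
    actionTerm ρ i (c • φ) = c • actionTerm ρ i φ := by
  ext x
  simp [actionTerm]

/-- The differential of a cochain `φ : gⁿ → M`, where `g` acts on `M` by `ρ`. On homogeneous
`x₀, …, xₙ` and for `φ` of parity `|φ|`,
`(dφ)(x₀, …, xₙ) = ∑ᵢ (-1)^(i + |xᵢ|(|φ| + |x₀| + ⋯ + |xᵢ₋₁|)) xᵢ · φ(x₀, …, x̂ᵢ, …, xₙ)`
`  + ∑_{i<j} (-1)^(j + |xⱼ|(|xᵢ₊₁| + ⋯ + |xⱼ₋₁|)) φ(x₀, …, [xᵢ, xⱼ], …, x̂ⱼ, …, xₙ)`.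
In particular `(dm)(x) = (-1)^(|x||m|) x · m` in degree `0`, and `(df)(x, y) = -f([x, y])` for
`f ∈ g*`. -/
noncomputable def differential [LieSuperalgebra K g] [SuperSpace K M] (ρ : g →ₗ[K] M →ₗ[K] M)
    (n : ℕ) :
    MultilinearMap K (fun _ : Fin n => g) M →ₗ[K]
      MultilinearMap K (fun _ : Fin (n + 1) => g) M where
  toFun φ := ofHomogeneous fun ε =>
    (∑ s : ZMod 2, ∑ i : Fin (n + 1),
      sgn K (((i : ℕ) : ZMod 2) + ε i * (s + ∑ l ∈ Finset.Iio i, ε l)) •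
        actionTerm ρ i (parityPart s φ)) +
    ∑ i : Fin (n + 1), ∑ j : Fin (n + 1), if hij : i < j then
      sgn K (((j : ℕ) : ZMod 2) + ε j * ∑ l ∈ Finset.Ioo i j, ε l) • bracketTerm i j hij φ
    else 0
  map_add' φ ψ := by
    rw [← ofHomogeneous_add]
    congr 1
    funext ε
    rw [add_add_add_comm]
    simp only [← Finset.sum_add_distrib]
    congr 1
    · simp only [parityPart_add, actionTerm_add, smul_add]
    · refine Finset.sum_congr rfl fun i _ => Finset.sum_congr rfl fun j _ => ?_
      split_ifs
      · rw [← smul_add]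
        rfl
      · simp
  map_smul' c φ := by
    rw [RingHom.id_apply, ← ofHomogeneous_smul]
    congr 1
    funext ε
    rw [smul_add]
    simp only [Finset.smul_sum]
    congr 1
    · refine Finset.sum_congr rfl fun i _ => Finset.sum_congr rfl fun j _ => ?_
      rw [parityPart_smul, actionTerm_smul, smul_comm]
    · refine Finset.sum_congr rfl fun i _ => Finset.sum_congr rfl fun j _ => ?_
      split_ifs
      · rw [smul_comm c]
        rfl
      · simp

/-! ### Products of cochains -/

/-- `(x₁, …, x_{q+p}) ↦ f(x₁, …, x_q) ⋆ h(x_{q+1}, …, x_{q+p})`, for a bilinear map `⋆`. -/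
noncomputable def juxtapose {q p : ℕ} (star : M₁ →ₗ[K] M₂ →ₗ[K] M₃)
    (f : MultilinearMap K (fun _ : Fin q => g) M₁) (h : MultilinearMap K (fun _ : Fin p => g) M₂) :
    MultilinearMap K (fun _ : Fin (q + p) => g) M₃ :=
  (TensorProduct.lift star).compMultilinearMap ((f.domCoprod h).domDomCongr finSumFinEquiv)

/-- `γ(x, σ) = ∏ (-1)^(|x_{σ(i)}| |x_{σ(j)}|)` over the inversions `i < j`, `σ(i) > σ(j)` of `σ`,
for a tuple `x` of homogeneous elements with parities `ε`. -/
def koszulSign (K : Type*) [Field K] {n : ℕ} (ε : Fin n → ZMod 2) (σ : Equiv.Perm (Fin n)) : K :=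
  ∏ i : Fin n, ∏ j : Fin n, if i < j ∧ σ j < σ i then sgn K (ε (σ i) * ε (σ j)) else 1

/-- The cup product of `f : g^q → M₁` and `h : g^p → M₂` with respect to a bilinear map `⋆`:
`f ∪ h = (1 / (p! q!)) ∑_σ F_σ(f, h)`, where for homogeneous `x = (x₁, …, x_{q+p})` and `h` of
parity `|h|`,
`F_σ(f, h)(x) = (-1)^((|x_{σ(1)}| + ⋯ + |x_{σ(q)}|) |h|) sign(σ) γ(x, σ)`
`  f(x_{σ(1)}, …, x_{σ(q)}) ⋆ h(x_{σ(q+1)}, …, x_{σ(q+p)})`. -/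
noncomputable def cup [SuperSpace K g] [SuperSpace K M₂] {q p : ℕ}
    (star : M₁ →ₗ[K] M₂ →ₗ[K] M₃)
    (f : MultilinearMap K (fun _ : Fin q => g) M₁) (h : MultilinearMap K (fun _ : Fin p => g) M₂) :
    MultilinearMap K (fun _ : Fin (q + p) => g) M₃ :=
  ofHomogeneous fun ε =>
    ((p.factorial : K) * (q.factorial : K))⁻¹ •
      ∑ t : ZMod 2, ∑ σ : Equiv.Perm (Fin (q + p)),
        (sgn K ((∑ i : Fin q, ε (σ (Fin.castAdd p i))) * t) *
          ((Equiv.Perm.sign σ : ℤ) : K) * koszulSign K ε σ) •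
            (juxtapose star f (parityPart t h)).domDomCongr σ

/-- The product of the super-exterior algebra `⋀ g*`, as an algebra of super-alternating forms. -/
noncomputable def wedge [SuperSpace K g] {q p : ℕ}
    (f : MultilinearMap K (fun _ : Fin q => g) K) (h : MultilinearMap K (fun _ : Fin p => g) K) :
    MultilinearMap K (fun _ : Fin (q + p) => g) K :=
  cup (LinearMap.mul K K) f h

end Cochains

section Cohomology

variable (K g : Type*) [Field K] [AddCommGroup g] [Module K g] [LieSuperalgebra K g]

/-- The differential of the complex `⋀ g*` of cochains with trivial coefficients. -/
noncomputable def trivialD (n : ℕ) :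
    MultilinearMap K (fun _ : Fin n => g) K →ₗ[K] MultilinearMap K (fun _ : Fin (n + 1) => g) K :=
  differential 0 n

/-- The differential of the complex `g ⊗ ⋀ g*` of cochains with coefficients in the adjoint
module. -/
noncomputable def adjointD (n : ℕ) :
    MultilinearMap K (fun _ : Fin n => g) g →ₗ[K] MultilinearMap K (fun _ : Fin (n + 1) => g) g :=
  differential bracket n

/-- The `n`-cocycles with coefficients in the adjoint module. -/
noncomputable def cocycles (n : ℕ) : Submodule K (MultilinearMap K (fun _ : Fin n => g) g) :=
  cochains K g g n ⊓ LinearMap.ker (adjointD K g n)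

/-- The `n`-coboundaries with coefficients in the adjoint module: `Im d` in degree `n`. -/
noncomputable def coboundaries : (n : ℕ) → Submodule K (MultilinearMap K (fun _ : Fin n => g) g)
  | 0 => ⊥
  | n + 1 => (cochains K g g n).map (adjointD K g n)

/-- The cup product on the adjoint cohomology `H^n(g, g) = cocycles n / coboundaries n`, which is
induced by the cup product of cochains with respect to the bracket of `g`, is trivial: products
of cocycles are coboundaries. -/
def CupProductTrivial : Prop :=
  ∀ (q p : ℕ), ∀ f ∈ cocycles K g q, ∀ h ∈ cocycles K g p,
    cup bracket f h ∈ coboundaries K g (q + p)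

/-- `⋀ᵏ V*` as a subspace of `⋀ᵏ g*`, for a complement `V` of `[g, g]`. Through
`g = [g, g] ⊕ V` the forms on `V` become the forms on `g` that vanish as soon as one argument lies
in `[g, g]`; this subspace does not depend on `V`. -/
def complementForms (k : ℕ) : Submodule K (MultilinearMap K (fun _ : Fin k => g) K) where
  carrier := {w | w ∈ cochains K g K k ∧ ∀ (x : Fin k → g) (i : Fin k), x i ∈ derived K g → w x = 0}
  zero_mem' := ⟨Submodule.zero_mem _, fun _ _ _ => rfl⟩
  add_mem' := by
    rintro w w' ⟨h, h0⟩ ⟨h', h0'⟩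
    refine ⟨Submodule.add_mem _ h h', fun x i hi => ?_⟩
    rw [add_apply, h0 x i hi, h0' x i hi, add_zero]
  smul_mem' := by
    rintro c w ⟨h, h0⟩
    refine ⟨Submodule.smul_mem _ c h, fun x i hi => ?_⟩
    rw [smul_apply, h0 x i hi, smul_zero]

/-- `[g, g] ⊗ ⋀ᵏ V*` as a subspace of `g ⊗ ⋀ᵏ g*`: the span of the `z ⊗ w : x ↦ w(x) z`. -/
def derivedTensorForms (k : ℕ) : Submodule K (MultilinearMap K (fun _ : Fin k => g) g) :=
  Submodule.span K {φ | ∃ z ∈ derived K g, ∃ w ∈ complementForms K g k, w.smulRight z = φ}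

end Cohomology

end LieSuperalgebra

/-!
Write `Z = [g, g]`; it is central. The coboundary of a `0`-cochain `m` is `x ↦ -[m, x]`, so the
hypothesis `h1` for `k = 1` yields that every map `x ↦ w(x) z` with `z ∈ Z` and `w` a linear form
on `g / Z` is an inner derivation. This forces `dim Z = 1`
(`IsStepNilpotent.exists_derived_eq_span`): choose `z ∈ Z` homogeneous and `u ∉ Z` with `[u, g] ⊆
K z`; then also `[g, u] ⊆ K z`, while every `z' ∈ Z` is some `[m, u]`, because `x ↦ w(x) z'` is an
inner derivation for a form `w` with `w(u) = 1`.

Let `Z = K z` and let `f` be the linear form with `f(z) = 1` that vanishes on `V`, so that `df`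
is, up to sign, the coefficient of the bracket. By `h2`, multiplication by `df` is injective on
`⋀ᵏ V*` for `k ≥ 1`. If `z` were odd then `df` would be an odd form of degree two and `df ∧ df =
0` (`wedge_self_eq_zero`), which is absurd. So `z` is even.

Composing an adjoint cocycle with a linear form that kills `Z` gives a cocycle `ψ` with trivial
coefficients. Its interior product `b = ψ(z, ·)` lies in `⋀ V*` because `z` is even, and `dψ = 0`
gives `df ∧ b = 0` (`wedge_curryLeft_eq_zero`): the summands of `dψ`, indexed by pairs `i < j`,
become equal after summation over all permutations with signs, and the common value is a multiple
of `df ∧ b`. Hence `b = 0`, that is, `ψ` vanishes as soon as one argument lies in `Z`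
(`scalar_cocycle_eq_zero`). So an adjoint cocycle with one argument in `Z` takes its value in `Z`.
Since `Z` is central, a cup product of two cocycles vanishes if one argument lies in `Z`; its
values lie in `Z = K z`, so it is `w ⊗ z` with `w ∈ ⋀ V*`, a coboundary by `h1`. In degree zero
cocycles are central elements, and their bracket is zero.
-/

namespace SuperSpace

/-! ### Signs and parities -/

section Sign

variable (K : Type*) [Field K]

theorem sgn_zero : sgn K 0 = 1 := by simp [sgn]

theorem sgn_one : sgn K 1 = -1 := by
  have : (1 : ZMod 2).val = 1 := rfl
  simp [sgn, this]

theorem sgn_add (a b : ZMod 2) : sgn K (a + b) = sgn K a * sgn K b := by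
  have h : ∀ c : ZMod 2, c = 0 ∨ c = 1 := by decide
  have h2 : (1 + 1 : ZMod 2) = 0 := rfl
  rcases h a with rfl | rfl <;> rcases h b with rfl | rfl <;> simp [sgn_zero, sgn_one, h2]

theorem sgn_mul_self (a : ZMod 2) : sgn K a * sgn K a = 1 := by
  rw [← sgn_add, CharTwo.add_self_eq_zero, sgn_zero]

end Sign

section Parity

variable (K : Type*) {M : Type*} [Field K] [AddCommGroup M] [Module K M] [SuperSpace K M]

theorem proj_mem (a : ZMod 2) (x : M) : proj K a x ∈ part K (M := M) a := by
  unfold proj part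
  split_ifs
  · exact Submodule.projection_apply_mem _ _
  · exact Submodule.projection_apply_mem _ _

variable {K}

theorem proj_of_mem {a : ZMod 2} {x : M} (hx : x ∈ part K a) : proj K a x = x := by
  unfold proj
  unfold part at hx
  split_ifs at hx ⊢
  · exact Submodule.projection_apply_of_mem_left _ hx
  · exact Submodule.projection_apply_of_mem_left _ hx

theorem proj_of_mem_of_ne {a b : ZMod 2} (hab : b ≠ a) {x : M} (hx : x ∈ part K a) :
    proj K b x = 0 := by
  have h : ∀ c : ZMod 2, c = 0 ∨ c = 1 := by decide
  rcases h a with rfl | rfl <;> rcases h b with rfl | rfl <;> simp [proj, part] at *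
  · exact hx
  · exact hx

variable (K)

theorem sum_proj (x : M) : ∑ a : ZMod 2, proj K a x = x := by
  have : ∑ a : ZMod 2, proj K a x = proj K 0 x + proj K 1 x := Fin.sum_univ_two _
  rw [this]
  simp only [proj, if_true, one_ne_zero, if_false]
  exact Submodule.projection_add_projection_eq_self _ x

end Parity

end SuperSpace

namespace LieSuperalgebra

open SuperSpace

/-! ### The Koszul sign -/

section Koszul

variable {K : Type*} [Field K]

/-- A product over unordered pairs is invariant under permutations of the index set. -/
theorem prod_Ioi_comp_perm {n : ℕ} (σ : Equiv.Perm (Fin n)) {h : Fin n → Fin n → K}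
    (hh : ∀ i j, h i j = h j i) :
    ∏ i, ∏ j ∈ Finset.Ioi i, h (σ i) (σ j) = ∏ i, ∏ j ∈ Finset.Ioi i, h i j := by
  -- Multiplying by the antisymmetric `s` reduces this to the case of antisymmetric functions.
  let s : Fin n → Fin n → K := fun i j => if i < j then 1 else if j < i then -1 else 0
  have hs : ∀ i j, s i j = -s j i := by
    intro i j
    rcases lt_trichotomy i j with h | h | h
    · simp [s, h, h.not_gt]
    · simp [s, h]
    · simp [s, h, h.not_gt]
  have hs1 : ∏ i, ∏ j ∈ Finset.Ioi i, s i j = 1 :=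
    Finset.prod_eq_one fun i _ => Finset.prod_eq_one fun j hj => if_pos (Finset.mem_Ioi.1 hj)
  have e1 := σ.prod_Ioi_comp_eq_sign_mul_prod hs
  have e2 := σ.prod_Ioi_comp_eq_sign_mul_prod (f := fun i j => s i j * h i j)
    (fun i j => by rw [hs, hh, neg_mul])
  simp only [Finset.prod_mul_distrib, e1, hs1, mul_one, one_mul] at e2
  refine mul_left_cancel₀ ?_ e2
  rcases Int.units_eq_one_or (Equiv.Perm.sign σ) with h | h <;> simp [h]

theorem koszulSign_eq_prod_Ioi {n : ℕ} (ε : Fin n → ZMod 2) (σ : Equiv.Perm (Fin n)) :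
    koszulSign K ε σ = ∏ i, ∏ j ∈ Finset.Ioi i,
      if σ j < σ i then sgn K (ε (σ i) * ε (σ j)) else 1 := by
  unfold koszulSign
  refine Finset.prod_congr rfl fun i _ => ?_
  have : Finset.Ioi i = Finset.univ.filter (fun j => i < j) := by ext; simp
  rw [this, Finset.prod_filter]
  refine Finset.prod_congr rfl fun j _ => ?_
  by_cases h : i < j <;> simp [h]

/-- The cocycle property of the Koszul sign. -/
theorem koszulSign_mul {n : ℕ} (ε : Fin n → ZMod 2) (σ τ : Equiv.Perm (Fin n)) :
    koszulSign K ε (σ * τ) = koszulSign K ε σ * koszulSign K (ε ∘ σ) τ := by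
  -- `h a b` is the contribution of the unordered pair `{a, b}` to the sign of `σ`.
  let h : Fin n → Fin n → K := fun a b =>
    if (a < b ∧ σ b < σ a) ∨ (b < a ∧ σ a < σ b) then sgn K (ε (σ a) * ε (σ b)) else 1
  have hh : ∀ a b, h a b = h b a := by
    intro a b
    simp only [h, mul_comm (ε (σ a))]
    congr 1
    exact propext or_comm
  have e1 : koszulSign K ε σ = ∏ i, ∏ j ∈ Finset.Ioi i, h i j := by
    rw [koszulSign_eq_prod_Ioi]
    refine Finset.prod_congr rfl fun i _ => Finset.prod_congr rfl fun j hj => ?_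
    have hij := Finset.mem_Ioi.1 hj
    simp [h, hij, hij.not_gt]
  rw [e1, ← prod_Ioi_comp_perm τ hh, koszulSign_eq_prod_Ioi, koszulSign_eq_prod_Ioi,
    ← Finset.prod_mul_distrib]
  refine Finset.prod_congr rfl fun i _ => ?_
  rw [← Finset.prod_mul_distrib]
  refine Finset.prod_congr rfl fun j hj => ?_
  have hij : τ i ≠ τ j := τ.injective.ne (Finset.mem_Ioi.1 hj).ne
  have hij' : σ (τ i) ≠ σ (τ j) := σ.injective.ne hij
  have hsq := sgn_mul_self K (ε (σ (τ i)) * ε (σ (τ j)))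
  rcases lt_or_gt_of_ne hij with h1 | h1 <;> rcases lt_or_gt_of_ne hij' with h2 | h2 <;>
    simp [h, h1, h1.not_gt, h2, h2.not_gt, hsq]

/-- The Koszul sign of an adjacent transposition. -/
theorem koszulSign_swap {n : ℕ} (ε : Fin n → ZMod 2) {i j : Fin n} (hij : (i : ℕ) + 1 = j) :
    koszulSign K ε (Equiv.swap i j) = sgn K (ε i * ε j) := by
  have hlt : i < j := by rw [Fin.lt_def]; omega
  unfold koszulSign
  rw [Finset.prod_eq_single i, Finset.prod_eq_single j]
  · simp [hlt, mul_comm]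
  · intro l _ hl
    refine if_neg ?_
    rintro ⟨h1, h2⟩
    rw [Equiv.swap_apply_left, Equiv.swap_apply_of_ne_of_ne h1.ne' hl] at h2
    rw [Fin.lt_def] at h1 h2
    omega
  · simp
  · intro l _ hl
    refine Finset.prod_eq_one fun m _ => if_neg ?_
    rintro ⟨h1, h2⟩
    simp only [Equiv.swap_apply_def, Fin.lt_def, Fin.ext_iff] at h1 h2 hl
    split_ifs at h2 <;> omega
  · simp

end Koszul

/-! ### Super-alternization -/

section SuperAlternization

variable {K g M : Type*} [Field K] [AddCommGroup M] [Module K M]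

/-- The sum `∑_σ sign(σ) γ(x, σ) F(x_{σ(1)}, …, x_{σ(n)})` over all permutations, for a tuple `x`
of homogeneous elements with parities `ε`. The function `F` may depend on the parities. -/
def superAlt {n : ℕ} (F : (Fin n → ZMod 2) → (Fin n → g) → M) (ε : Fin n → ZMod 2)
    (x : Fin n → g) : M :=
  ∑ σ : Equiv.Perm (Fin n),
    (((Equiv.Perm.sign σ : ℤ) : K) * koszulSign K ε σ) • F (ε ∘ σ) (x ∘ σ)

theorem signCast_mul {n : ℕ} (σ τ : Equiv.Perm (Fin n)) :
    ((Equiv.Perm.sign (σ * τ) : ℤ) : K) =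
      ((Equiv.Perm.sign σ : ℤ) : K) * ((Equiv.Perm.sign τ : ℤ) : K) := by
  rw [Equiv.Perm.sign_mul]
  push_cast
  rfl

/-- The super-alternization is super-alternating. -/
theorem superAlt_comp_swap {n : ℕ} (F : (Fin n → ZMod 2) → (Fin n → g) → M)
    (ε : Fin n → ZMod 2) (x : Fin n → g) {i j : Fin n} (hij : (i : ℕ) + 1 = j) :
    superAlt (K := K) F (ε ∘ Equiv.swap i j) (x ∘ Equiv.swap i j) =
      -(sgn K (ε i * ε j) • superAlt (K := K) F ε x) := by
  have hne : i ≠ j := by rintro rfl; omega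
  unfold superAlt
  rw [Finset.smul_sum, ← Finset.sum_neg_distrib]
  refine Fintype.sum_equiv (Equiv.mulLeft (Equiv.swap i j)) _ _ fun σ => ?_
  rw [Equiv.coe_mulLeft, signCast_mul, koszulSign_mul, koszulSign_swap ε hij,
    Equiv.Perm.sign_swap hne, smul_smul, ← neg_smul]
  congr 1
  have hsq := sgn_mul_self K (ε i * ε j)
  push_cast
  linear_combination
    (-(((Equiv.Perm.sign σ : ℤ) : K) * koszulSign K (ε ∘ Equiv.swap i j) σ)) * hsq

variable [AddCommGroup g] [Module K g] [SuperSpace K g]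

/-- Super-alternization does not see a preliminary permutation of the arguments which is
accompanied by its signs. -/
theorem superAlt_congr_perm {n : ℕ} (τ : Equiv.Perm (Fin n))
    {F G : (Fin n → ZMod 2) → (Fin n → g) → M}
    (hG : ∀ ε x, (∀ i, x i ∈ part K (ε i)) →
      G ε x = (((Equiv.Perm.sign τ : ℤ) : K) * koszulSign K ε τ) • F (ε ∘ τ) (x ∘ τ))
    {ε : Fin n → ZMod 2} {x : Fin n → g} (hx : ∀ i, x i ∈ part K (ε i)) :
    superAlt (K := K) G ε x = superAlt (K := K) F ε x := by
  unfold superAlt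
  refine Fintype.sum_equiv (Equiv.mulRight τ) _ _ fun σ => ?_
  rw [hG (ε ∘ σ) (x ∘ σ) fun i => hx (σ i), Equiv.coe_mulRight, signCast_mul, koszulSign_mul,
    smul_smul]
  congr 1
  ring

end SuperAlternization

/-! ### Multilinear maps and homogeneous arguments -/

section Homogeneous

variable {K g M : Type*} [Field K] [AddCommGroup g] [Module K g] [AddCommGroup M] [Module K M]
  [SuperSpace K g]

theorem ofHomogeneous_apply {n : ℕ}
    (F : (Fin n → ZMod 2) → MultilinearMap K (fun _ : Fin n => g) M)
    {ε : Fin n → ZMod 2} {x : Fin n → g} (hx : ∀ i, x i ∈ part K (ε i)) :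
    ofHomogeneous F x = F ε x := by
  simp only [ofHomogeneous, sum_apply, MultilinearMap.compLinearMap_apply]
  rw [Finset.sum_eq_single ε]
  · congr 1
    funext i
    exact proj_of_mem (hx i)
  · intro δ _ hδ
    obtain ⟨i, hi⟩ := Function.ne_iff.1 hδ
    exact (F δ).map_coord_zero i (proj_of_mem_of_ne hi (hx i))
  · simp

theorem ofHomogeneous_const {n : ℕ} (φ : MultilinearMap K (fun _ : Fin n => g) M) :
    ofHomogeneous (fun _ => φ) = φ := by
  ext x
  simp only [ofHomogeneous, sum_apply, MultilinearMap.compLinearMap_apply]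
  rw [← φ.map_sum (fun i (a : ZMod 2) => proj K a (x i))]
  congr 1
  funext i
  exact sum_proj K (x i)

/-- Multilinear maps are determined by their values on homogeneous elements. -/
theorem ext_homogeneous {n : ℕ} {φ ψ : MultilinearMap K (fun _ : Fin n => g) M}
    (h : ∀ (ε : Fin n → ZMod 2) (x : Fin n → g), (∀ i, x i ∈ part K (ε i)) → φ x = ψ x) :
    φ = ψ := by
  rw [← ofHomogeneous_const φ, ← ofHomogeneous_const ψ]
  ext x
  simp only [ofHomogeneous, sum_apply, MultilinearMap.compLinearMap_apply]
  exact Finset.sum_congr rfl fun ε _ => h ε _ fun i => proj_mem K _ _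

/-- The exchange rule need only be checked on homogeneous tuples. -/
theorem mem_cochains_of_homogeneous {n : ℕ} {φ : MultilinearMap K (fun _ : Fin n => g) M}
    (h : ∀ i j : Fin n, (i : ℕ) + 1 = j → ∀ (ε : Fin n → ZMod 2) (x : Fin n → g),
      (∀ l, x l ∈ part K (ε l)) → φ (x ∘ Equiv.swap i j) = -(sgn K (ε i * ε j) • φ x)) :
    φ ∈ cochains K g M n := by
  intro i j hij a b x hi hj
  have hne : i ≠ j := by rintro rfl; omega
  -- Both sides are multilinear once the entries `i`, `j` are projected to their parities.
  let P : Fin n → (g →ₗ[K] g) := fun l =>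
    if l = i then proj K a else if l = j then proj K b else LinearMap.id
  have key : ((φ.domDomCongr (Equiv.swap i j)).compLinearMap P) =
      -(sgn K (a * b) • φ.compLinearMap P) := by
    refine ext_homogeneous fun ε y hy => ?_
    have := h i j hij (Function.update (Function.update ε j b) i a) (fun l => P l (y l)) ?_
    · simpa [hne, hne.symm, Function.comp_def] using this
    · intro l
      rcases eq_or_ne l i with rfl | h1
      · simpa [P] using proj_mem K a (y l)
      · rcases eq_or_ne l j with rfl | h2
        · simpa [P, h1] using proj_mem K b (y l)
        · simpa [P, h1, h2] using hy l
  have hP : (fun l => P l (x l)) = x := by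
    funext l
    rcases eq_or_ne l i with rfl | h1
    · simpa [P] using proj_of_mem hi
    · rcases eq_or_ne l j with rfl | h2
      · simpa [P, h1] using proj_of_mem hj
      · simp [P, h1, h2]
  have := congrArg (fun ψ => ψ x) key
  simpa [hP, MultilinearMap.domDomCongr_apply] using this

end Homogeneous

/-! ### The cup product on homogeneous arguments -/

section CupEvaluation

variable {K g M₁ M₂ M₃ : Type*} [Field K] [AddCommGroup g] [Module K g]
  [AddCommGroup M₁] [Module K M₁]
  [AddCommGroup M₂] [Module K M₂] [AddCommGroup M₃] [Module K M₃]

theorem juxtapose_apply {q p : ℕ} (star : M₁ →ₗ[K] M₂ →ₗ[K] M₃)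
    (f : MultilinearMap K (fun _ : Fin q => g) M₁) (h : MultilinearMap K (fun _ : Fin p => g) M₂)
    (x : Fin (q + p) → g) :
    juxtapose star f h x = star (f (x ∘ Fin.castAdd p)) (h (x ∘ Fin.natAdd q)) := by
  simp [juxtapose, Function.comp_def, MultilinearMap.domDomCongr_apply]

/-- The summand of the cup product of `f` and `h` at the identity permutation. -/
noncomputable def cupSummand [SuperSpace K g] [SuperSpace K M₂] {q p : ℕ}
    (star : M₁ →ₗ[K] M₂ →ₗ[K] M₃)
    (f : MultilinearMap K (fun _ : Fin q => g) M₁) (h : MultilinearMap K (fun _ : Fin p => g) M₂)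
    (ε : Fin (q + p) → ZMod 2) (x : Fin (q + p) → g) : M₃ :=
  ∑ t : ZMod 2, sgn K ((∑ i : Fin q, ε (Fin.castAdd p i)) * t) •
    star (f (x ∘ Fin.castAdd p)) (parityPart t h (x ∘ Fin.natAdd q))

theorem cup_apply [SuperSpace K g] [SuperSpace K M₂] {q p : ℕ} (star : M₁ →ₗ[K] M₂ →ₗ[K] M₃)
    (f : MultilinearMap K (fun _ : Fin q => g) M₁) (h : MultilinearMap K (fun _ : Fin p => g) M₂)
    {ε : Fin (q + p) → ZMod 2} {x : Fin (q + p) → g} (hx : ∀ i, x i ∈ part K (ε i)) :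
    cup star f h x = ((p.factorial : K) * (q.factorial : K))⁻¹ •
      superAlt (K := K) (cupSummand star f h) ε x := by
  rw [cup, ofHomogeneous_apply _ hx]
  simp only [smul_apply, sum_apply, MultilinearMap.domDomCongr_apply, juxtapose_apply, superAlt,
    cupSummand, Finset.smul_sum]
  rw [Finset.sum_comm]
  refine Finset.sum_congr rfl fun σ _ => Finset.sum_congr rfl fun t _ => ?_
  rw [smul_smul (_ * _) (sgn K _)]
  congr 2
  simp only [Function.comp_apply]
  ring

theorem cup_mem_cochains [SuperSpace K g] [SuperSpace K M₂] {q p : ℕ}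
    (star : M₁ →ₗ[K] M₂ →ₗ[K] M₃)
    (f : MultilinearMap K (fun _ : Fin q => g) M₁)
    (h : MultilinearMap K (fun _ : Fin p => g) M₂) :
    cup star f h ∈ cochains K g M₃ (q + p) := by
  refine mem_cochains_of_homogeneous fun i j hij ε x hx => ?_
  rw [cup_apply star f h hx, cup_apply star f h (ε := ε ∘ Equiv.swap i j)
    (x := x ∘ Equiv.swap i j) fun l => hx _,
    superAlt_comp_swap _ _ _ hij, smul_neg, smul_comm]

/-- A scalar form has, at homogeneous arguments, the parity of their sum. -/
theorem parityPart_scalar_apply [SuperSpace K g] {n : ℕ} (t : ZMod 2)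
    (φ : MultilinearMap K (fun _ : Fin n => g) K) {ε : Fin n → ZMod 2} {x : Fin n → g}
    (hx : ∀ i, x i ∈ part K (ε i)) :
    parityPart t φ x = if t = ∑ i, ε i then φ x else 0 := by
  have hmem : φ x ∈ part K (M := K) 0 := by simp [part, SuperSpace.even]
  rw [parityPart, ofHomogeneous_apply _ hx, LinearMap.compMultilinearMap_apply]
  split_ifs with h
  · rw [h, CharTwo.add_self_eq_zero, proj_of_mem hmem]
  · exact proj_of_mem_of_ne (fun e => h (CharTwo.add_eq_zero.1 e)) hmem

theorem cupSummand_mul_apply [SuperSpace K g] {q p : ℕ}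
    (f : MultilinearMap K (fun _ : Fin q => g) K) (h : MultilinearMap K (fun _ : Fin p => g) K)
    {ε : Fin (q + p) → ZMod 2} {x : Fin (q + p) → g} (hx : ∀ i, x i ∈ part K (ε i)) :
    cupSummand (LinearMap.mul K K) f h ε x =
      sgn K ((∑ i : Fin q, ε (Fin.castAdd p i)) * ∑ i : Fin p, ε (Fin.natAdd q i)) *
        (f (x ∘ Fin.castAdd p) * h (x ∘ Fin.natAdd q)) := by
  unfold cupSummand
  rw [Finset.sum_eq_single (∑ i : Fin p, ε (Fin.natAdd q i))]
  · rw [parityPart_scalar_apply (ε := ε ∘ Fin.natAdd q) (x := x ∘ Fin.natAdd q) _ _ fun i => hx _]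
    simp
  · intro t _ ht
    rw [parityPart_scalar_apply (ε := ε ∘ Fin.natAdd q) (x := x ∘ Fin.natAdd q) _ _ fun i => hx _]
    simp only [Function.comp_apply]
    rw [if_neg ht]
    simp
  · simp

end CupEvaluation

/-! ### The differential on homogeneous arguments -/

section Differential

variable {K g M : Type*} [Field K] [AddCommGroup g] [Module K g] [LieSuperalgebra K g]
  [AddCommGroup M] [Module K M]

theorem trivialD_apply {n : ℕ} (φ : MultilinearMap K (fun _ : Fin n => g) K)
    {ε : Fin (n + 1) → ZMod 2} {x : Fin (n + 1) → g} (hx : ∀ i, x i ∈ part K (ε i)) :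
    trivialD K g n φ x = ∑ i : Fin (n + 1), ∑ j : Fin (n + 1), if i < j then
      sgn K (((j : ℕ) : ZMod 2) + ε j * ∑ l ∈ Finset.Ioo i j, ε l) *
        φ (j.removeNth (Function.update x i (bracket (K := K) (x i) (x j)))) else 0 := by
  simp only [trivialD, differential, LinearMap.coe_mk, AddHom.coe_mk]
  rw [ofHomogeneous_apply _ hx]
  simp only [add_apply, sum_apply, smul_apply, actionTerm, MultilinearMap.mk'_apply,
    LinearMap.zero_apply, smul_zero, Finset.sum_const_zero, zero_add]
  refine Finset.sum_congr rfl fun i _ => Finset.sum_congr rfl fun j _ => ?_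
  split_ifs
  · rfl
  · rfl

theorem trivialD_oneForm_apply (f : Module.Dual K g) (x : Fin 2 → g) :
    trivialD K g 1 (oneForm f) x = -f (bracket (K := K) (x 0) (x 1)) := by
  let B : MultilinearMap K (fun _ : Fin 2 => g) K :=
    bracketTerm (0 : Fin 2) 1 (by decide) (oneForm f)
  have hB : ∀ y, B y = f (bracket (K := K) (y 0) (y 1)) := by
    intro y
    simp [B, bracketTerm, oneForm, Fin.removeNth]
  rw [← hB]
  suffices trivialD K g 1 (oneForm f) = -B by rw [this]; rfl
  refine ext_homogeneous fun ε y hy => ?_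
  rw [trivialD_apply _ hy, neg_apply, hB]
  have : ∀ v, oneForm f v = f (v 0) := fun v => rfl
  have hIoo : Finset.Ioo (0 : Fin (1 + 1)) 1 = ∅ := rfl
  simp [Fin.sum_univ_two, this, Fin.removeNth, sgn_one, hIoo]

/-- A linear form that vanishes on `[g, g]` turns the differential with adjoint coefficients into
the differential with trivial coefficients. -/
theorem trivialD_compMultilinearMap {lam : g →ₗ[K] K}
    (hlam : ∀ x y : g, lam (bracket (K := K) x y) = 0) {n : ℕ}
    (φ : MultilinearMap K (fun _ : Fin n => g) g) :
    trivialD K g n (lam.compMultilinearMap φ) = lam.compMultilinearMap (adjointD K g n φ) := by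
  refine ext_homogeneous fun ε x hx => ?_
  rw [trivialD_apply _ hx]
  simp only [adjointD, differential, LinearMap.coe_mk, AddHom.coe_mk,
    LinearMap.compMultilinearMap_apply]
  rw [ofHomogeneous_apply _ hx]
  simp only [add_apply, sum_apply, smul_apply, actionTerm, MultilinearMap.mk'_apply, map_add,
    map_sum, map_smul, hlam, smul_zero, Finset.sum_const_zero, zero_add]
  refine Finset.sum_congr rfl fun i _ => Finset.sum_congr rfl fun j _ => ?_
  split_ifs
  · rw [smul_apply, map_smul]; rfl
  · simp

/-- The differential of the `0`-cochain `m` is `x ↦ -[m, x]`. -/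
theorem adjointD_zero_apply (φ : MultilinearMap K (fun _ : Fin 0 => g) g) (x : Fin 1 → g) :
    adjointD K g 0 φ x = -bracket (K := K) (φ 0) (x 0) := by
  let B : MultilinearMap K (fun _ : Fin 1 => g) g :=
    MultilinearMap.ofSubsingleton K g g (0 : Fin 1) (bracket (K := K) (φ 0))
  have hB : ∀ y, B y = bracket (K := K) (φ 0) (y 0) := fun y => rfl
  rw [← hB]
  suffices adjointD K g 0 φ = -B by rw [this]; rfl
  refine ext_homogeneous fun ε y hy => ?_
  simp only [adjointD, differential, LinearMap.coe_mk, AddHom.coe_mk]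
  rw [ofHomogeneous_apply _ hy, neg_apply, hB]
  have hpart : ∀ s (v : Fin 0 → g), parityPart s φ v = proj K s (φ 0) := by
    intro s v
    rw [parityPart, ofHomogeneous_apply (ε := 0) _ fun i => i.elim0,
      LinearMap.compMultilinearMap_apply, Subsingleton.elim v 0]
    simp
  have hIio : Finset.Iio (0 : Fin (0 + 1)) = ∅ := rfl
  have huniv : (Finset.univ : Finset (Fin (0 + 1))) = {0} := rfl
  simp only [sum_apply, smul_apply, actionTerm, MultilinearMap.mk'_apply, hpart,
    huniv, Finset.sum_singleton, hIio, Finset.sum_empty, add_zero, Fin.val_zero, Nat.cast_zero,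
    zero_add, lt_irrefl, dite_false]
  conv_rhs => rw [← sum_proj K (φ 0), map_sum, LinearMap.sum_apply, ← Finset.sum_neg_distrib]
  refine Finset.sum_congr rfl fun s _ => ?_
  rw [bracket_skew (ε 0) s _ _ (hy 0) (proj_mem K s (φ 0)), smul_neg, smul_smul, sgn_mul_self,
    one_smul]

end Differential

/-! ### The derived subalgebra is a line -/

section Structure

variable {K g : Type*} [Field K] [AddCommGroup g] [Module K g] [LieSuperalgebra K g]

theorem bracket_mem_derived (x y : g) : bracket (K := K) x y ∈ derived K g :=
  Submodule.subset_span ⟨x, y, rfl⟩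

theorem IsStepNilpotent.bracket_derived_right (hg : IsStepNilpotent K g 2) (x : g) {c : g}
    (hc : c ∈ derived K g) : bracket (K := K) x c = 0 := by
  have h1 : derived K g ≤ lcs K g 1 :=
    Submodule.span_mono fun z ⟨a, b, h⟩ => ⟨a, b, Submodule.mem_top, h⟩
  have h2 : bracket (K := K) x c ∈ lcs K g 2 := Submodule.subset_span ⟨x, c, h1 hc, rfl⟩
  rwa [hg.2.2, Submodule.mem_bot] at h2

theorem IsStepNilpotent.bracket_derived_left (hg : IsStepNilpotent K g 2) (x : g) {c : g}
    (hc : c ∈ derived K g) : bracket (K := K) c x = 0 := by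
  suffices derived K g ≤ LinearMap.ker ((bracket (K := K) (g := g)).flip x) from this hc
  refine Submodule.span_le.2 ?_
  rintro _ ⟨a, b, rfl⟩
  change bracket (K := K) (bracket (K := K) a b) x = 0
  rw [← sum_proj K a, ← sum_proj K b]
  simp only [map_sum, LinearMap.sum_apply]
  refine Finset.sum_eq_zero fun s _ => Finset.sum_eq_zero fun t _ => ?_
  -- In the Jacobi identity the two other terms are triple brackets `[·, [·, ·]]`.
  have h := jacobi (K := K) t s _ _ x (proj_mem K t a) (proj_mem K s b)
  simp only [hg.bracket_derived_right _ (bracket_mem_derived _ _), smul_zero, add_zero] at h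
  exact h.symm

/-- If all of `[g, g] ⊗ V*` consists of coboundaries, then each `x ↦ w(x) z` is of the form
`x ↦ [m, x]`. -/
theorem exists_bracket_eq (h1 : derivedTensorForms K g 1 ≤ coboundaries K g 1) {w : g →ₗ[K] K}
    (hw : ∀ c ∈ derived K g, w c = 0) {z : g} (hz : z ∈ derived K g) :
    ∃ m : g, ∀ x, bracket (K := K) m x = w x • z := by
  have hmem : (oneForm w).smulRight z ∈ derivedTensorForms K g 1 := by
    refine Submodule.subset_span ⟨z, hz, oneForm w, ⟨?_, ?_⟩, rfl⟩
    · intro i j hij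
      omega
    · intro x i hi
      rw [Subsingleton.elim i 0] at hi
      exact hw _ hi
  obtain ⟨φ, -, hφ⟩ := h1 hmem
  refine ⟨-φ 0, fun x => ?_⟩
  have := congrArg (fun ψ => ψ (fun _ => x)) hφ
  simp only [adjointD_zero_apply] at this
  rw [map_neg, LinearMap.neg_apply, this]
  rfl

/-- If a homogeneous element `z` is such that `[u, x]` is a multiple of `z` for all `x`, then so is
`[x, u]`, although `u` need not be homogeneous. -/
theorem bracket_mem_span_of_bracket_mem_span {a : ZMod 2} {z : g} (hz : z ∈ part K a) {u : g}
    (hu : ∀ x, bracket (K := K) u x ∈ Submodule.span K {z}) (x : g) :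
    bracket (K := K) x u ∈ Submodule.span K {z} := by
  -- Every homogeneous component of `u` has the same property.
  have hcomp : ∀ s b (y : g), y ∈ part K b →
      bracket (K := K) (proj K s u) y ∈ Submodule.span K {z} := by
    intro s b y hy
    have hdeg : ∀ t, bracket (K := K) (proj K t u) y ∈ part K (t + b) := fun t =>
      bracket_mem _ _ _ _ (proj_mem K t u) hy
    have hpr : proj K (s + b) (bracket (K := K) u y) = bracket (K := K) (proj K s u) y := by
      conv_lhs => rw [← sum_proj K u, map_sum, LinearMap.sum_apply, map_sum]
      rw [Finset.sum_eq_single s]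
      · exact proj_of_mem (hdeg s)
      · intro t _ ht
        exact proj_of_mem_of_ne (fun e => ht (add_right_cancel e).symm) (hdeg t)
      · simp
    obtain ⟨c, hc⟩ := Submodule.mem_span_singleton.1 (hu y)
    rw [← hpr, ← hc, map_smul]
    refine Submodule.smul_mem _ _ ?_
    by_cases h : s + b = a
    · rw [h, proj_of_mem hz]
      exact Submodule.mem_span_singleton_self z
    · rw [proj_of_mem_of_ne h hz]
      exact Submodule.zero_mem _
  rw [← sum_proj K x, ← sum_proj K u]
  simp only [map_sum, LinearMap.sum_apply]
  refine Submodule.sum_mem _ fun s _ => Submodule.sum_mem _ fun t _ => ?_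
  rw [bracket_skew t s _ _ (proj_mem K t x) (proj_mem K s u)]
  exact Submodule.neg_mem _ (Submodule.smul_mem _ _ (hcomp s t _ (proj_mem K t x)))

/-- If all of `[g, g] ⊗ V*` consists of coboundaries, then `[g, g]` is a line, spanned by a
homogeneous element. -/
theorem IsStepNilpotent.exists_derived_eq_span (hg : IsStepNilpotent K g 2)
    (h1 : derivedTensorForms K g 1 ≤ coboundaries K g 1) :
    ∃ (a : ZMod 2) (z : g), z ∈ part K a ∧ z ≠ 0 ∧ derived K g = Submodule.span K {z} := by
  have hne : derived K g ≠ ⊥ := by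
    intro h
    refine hg.2.1 (le_bot_iff.1 ?_)
    rw [← h]
    exact Submodule.span_mono fun z ⟨a, b, _, h⟩ => ⟨a, b, h⟩
  have hxy : ∃ x y : g, bracket (K := K) x y ≠ 0 := by
    by_contra! hcon
    refine hne (Submodule.span_eq_bot.2 ?_)
    rintro _ ⟨x, y, rfl⟩
    exact hcon x y
  obtain ⟨x, y, hxy⟩ := hxy
  have hz : ∃ (a : ZMod 2) (z : g), z ∈ part K a ∧ z ≠ 0 ∧ z ∈ derived K g := by
    by_contra! hcon
    refine hxy ?_
    rw [← sum_proj K x, ← sum_proj K y]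
    simp only [map_sum, LinearMap.sum_apply]
    refine Finset.sum_eq_zero fun s _ => Finset.sum_eq_zero fun t _ => ?_
    by_contra hst
    exact hcon _ _ (bracket_mem _ _ _ _ (proj_mem K _ _) (proj_mem K _ _)) hst
      (bracket_mem_derived _ _)
  obtain ⟨a, z, hza, hz0, hzd⟩ := hz
  refine ⟨a, z, hza, hz0, le_antisymm (fun z' hz' => ?_)
    ((Submodule.span_singleton_le_iff_mem _ _).2 hzd)⟩
  have hxd : x ∉ derived K g := fun h => hxy (hg.bracket_derived_left y h)
  obtain ⟨w, hwx, hw⟩ := Submodule.exists_le_ker_of_notMem hxd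
  obtain ⟨u, hu⟩ := exists_bracket_eq h1 (w := w) (fun c hc => hw hc) hzd
  have hud : u ∉ derived K g := fun h =>
    smul_ne_zero hwx hz0 (by rw [← hu, hg.bracket_derived_left x h])
  obtain ⟨w', hwu, hw'⟩ := Submodule.exists_le_ker_of_notMem hud
  obtain ⟨m, hm⟩ := exists_bracket_eq h1 (w := w') (fun c hc => hw' hc) hz'
  have hmu : bracket (K := K) m u ∈ Submodule.span K {z} :=
    bracket_mem_span_of_bracket_mem_span hza
      (fun v => by rw [hu]; exact Submodule.smul_mem _ _ (Submodule.mem_span_singleton_self z)) m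
  rw [hm] at hmu
  exact (Submodule.smul_mem_iff _ hwu).1 hmu

end Structure

/-! ### The differential of a scalar cochain when `[g, g]` is an even line -/

section PairSummand

variable {K g : Type*} [Field K] [AddCommGroup g] [Module K g] [LieSuperalgebra K g]

/-- The summand of `dψ` that belongs to the pair `i < j`, for a scalar-valued cochain `ψ`, when all
brackets are of the form `[x, y] = f([x, y]) z`. -/
noncomputable def pairSummand {k : ℕ} (f : g →ₗ[K] K) (z : g)
    (ψ : MultilinearMap K (fun _ : Fin (k + 1) => g) K) (i j : Fin (k + 2))
    (ε : Fin (k + 2) → ZMod 2) (x : Fin (k + 2) → g) : K :=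
  sgn K (((j : ℕ) : ZMod 2) + ε j * ∑ l ∈ Finset.Ioo i j, ε l) *
    (f (bracket (K := K) (x i) (x j)) * ψ (j.removeNth (Function.update x i z)))

/-- The summand of the pair `(i, j + 1)` arises from that of `(i, j)` by an adjacent transposition
of the arguments, with exactly its signs. -/
theorem superAlt_pairSummand_succ_right {k : ℕ} (f : g →ₗ[K] K) (z : g)
    (ψ : MultilinearMap K (fun _ : Fin (k + 1) => g) K) {i j j' : Fin (k + 2)} (hij : i < j)
    (hj : (j : ℕ) + 1 = j') {ε : Fin (k + 2) → ZMod 2} {x : Fin (k + 2) → g}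
    (hx : ∀ l, x l ∈ part K (ε l)) :
    superAlt (K := K) (pairSummand f z ψ i j') ε x =
      superAlt (K := K) (pairSummand f z ψ i j) ε x := by
  rw [Fin.lt_def] at hij
  refine superAlt_congr_perm (Equiv.swap j j') (fun ε x _ => ?_) hx
  have hne : j ≠ j' := by rintro rfl; omega
  have hij1 : i ≠ j := by rintro rfl; omega
  have hij2 : i ≠ j' := by rintro rfl; omega
  have harg : j.removeNth (Function.update (x ∘ Equiv.swap j j') i z) =
      j'.removeNth (Function.update x i z) := by
    funext l
    simp only [Fin.removeNth, Function.update_apply, Function.comp_apply, Fin.succAbove,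
      Equiv.swap_apply_def, Fin.lt_def, Fin.ext_iff]
    split_ifs <;> simp only [Fin.val_castSucc, Fin.val_succ] at * <;>
      first | rfl | omega | (congr 1; apply Fin.ext; simp; omega)
  have hsum : ∑ l ∈ Finset.Ioo i j', ε l =
      ε j + ∑ l ∈ Finset.Ioo i j, (ε ∘ Equiv.swap j j') l := by
    have : Finset.Ioo i j' = insert j (Finset.Ioo i j) := by
      ext l
      simp only [Finset.mem_Ioo, Finset.mem_insert, Fin.lt_def, Fin.ext_iff]
      omega
    rw [this, Finset.sum_insert (by simp)]
    congr 1
    refine Finset.sum_congr rfl fun l hl => ?_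
    rw [Finset.mem_Ioo, Fin.lt_def, Fin.lt_def] at hl
    rw [Function.comp_apply, Equiv.swap_apply_of_ne_of_ne]
    · rintro rfl; omega
    · rintro rfl; omega
  rw [pairSummand, pairSummand, harg, hsum, koszulSign_swap ε hj, Equiv.Perm.sign_swap hne, ← hj]
  simp only [Function.comp_apply, Equiv.swap_apply_left, Equiv.swap_apply_of_ne_of_ne hij1 hij2,
    smul_eq_mul, mul_add, sgn_add, Nat.cast_add, Nat.cast_one, sgn_one, mul_comm (ε j) (ε j')]
  push_cast
  ring

/-- The summand of the pair `(i + 1, j)` arises from that of `(i, j)` by an adjacent transposition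
of the arguments: it moves the even element `z` by one place in `ψ`, which costs a sign. -/
theorem superAlt_pairSummand_succ_left {k : ℕ} (f : g →ₗ[K] K) {z : g} (hz : z ∈ part K 0)
    (hf : ∀ a b (x y : g), x ∈ part K a → y ∈ part K b → a ≠ b → f (bracket (K := K) x y) = 0)
    {ψ : MultilinearMap K (fun _ : Fin (k + 1) => g) K} (hψ : ψ ∈ cochains K g K (k + 1))
    {i i' j : Fin (k + 2)} (hi : (i : ℕ) + 1 = i') (hij : i' < j)
    {ε : Fin (k + 2) → ZMod 2} {x : Fin (k + 2) → g} (hx : ∀ l, x l ∈ part K (ε l)) :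
    superAlt (K := K) (pairSummand f z ψ i' j) ε x =
      superAlt (K := K) (pairSummand f z ψ i j) ε x := by
  rw [Fin.lt_def] at hij
  refine superAlt_congr_perm (Equiv.swap i i') (fun ε x hx => ?_) hx
  have hne : i ≠ i' := by rintro rfl; omega
  have hij1 : j ≠ i := by rintro rfl; omega
  have hij2 : j ≠ i' := by rintro rfl; omega
  have hjk : (j : ℕ) < k + 2 := j.2
  let m : Fin (k + 1) := ⟨i, by omega⟩
  let m' : Fin (k + 1) := ⟨i', by omega⟩
  have hm : j.succAbove m = i := by
    rw [Fin.succAbove_of_castSucc_lt _ _ (by rw [Fin.lt_def]; simp [m]; omega)]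
    rfl
  have hm' : j.succAbove m' = i' := by
    rw [Fin.succAbove_of_castSucc_lt _ _ (by rw [Fin.lt_def]; simp [m']; omega)]
    rfl
  have harg : (fun l => j.removeNth (Function.update x i' z) (Equiv.swap m m' l)) =
      j.removeNth (Function.update (x ∘ Equiv.swap i i') i z) := by
    funext l
    simp only [Fin.removeNth]
    have : j.succAbove (Equiv.swap m m' l) = Equiv.swap i i' (j.succAbove l) := by
      rw [← hm, ← hm', Function.Injective.map_swap Fin.succAbove_right_injective]
    rw [this]
    rcases eq_or_ne (j.succAbove l) i with h | h
    · simp [h]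
    · have : Equiv.swap i i' (j.succAbove l) ≠ i' := by
        intro e
        exact h ((Equiv.swap i i').injective (e.trans (Equiv.swap_apply_left i i').symm))
      simp [Function.update_of_ne h, Function.update_of_ne this]
  have hψs : ψ (j.removeNth (Function.update (x ∘ Equiv.swap i i') i z)) =
      -ψ (j.removeNth (Function.update x i' z)) := by
    rw [← harg, hψ m m' hi (ε i) 0 _ ?_ ?_, mul_zero, sgn_zero, one_smul]
    · simp only [Fin.removeNth, hm, Function.update_of_ne hne]
      exact hx i
    · simpa only [Fin.removeNth, hm', Function.update_self] using hz
  have hsum : ∑ l ∈ Finset.Ioo i j, (ε ∘ Equiv.swap i i') l =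
      ε i + ∑ l ∈ Finset.Ioo i' j, ε l := by
    have : Finset.Ioo i j = insert i' (Finset.Ioo i' j) := by
      ext l
      simp only [Finset.mem_Ioo, Finset.mem_insert, Fin.lt_def, Fin.ext_iff]
      omega
    rw [this, Finset.sum_insert (by simp), Function.comp_apply, Equiv.swap_apply_right]
    congr 1
    refine Finset.sum_congr rfl fun l hl => ?_
    rw [Finset.mem_Ioo, Fin.lt_def, Fin.lt_def] at hl
    rw [Function.comp_apply, Equiv.swap_apply_of_ne_of_ne]
    · rintro rfl; omega
    · rintro rfl; omega
  rw [pairSummand, pairSummand, hψs, hsum, koszulSign_swap ε hi, Equiv.Perm.sign_swap hne]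
  simp only [Function.comp_apply, Equiv.swap_apply_left, Equiv.swap_apply_of_ne_of_ne hij1 hij2]
  -- Only the case `ε i' = ε j` matters: the Koszul sign and the sign of `j` then cancel.
  rcases eq_or_ne (ε i') (ε j) with he | he
  · have hsq := sgn_mul_self K (ε j * ε i)
    simp only [he, smul_eq_mul, mul_add, sgn_add, mul_comm (ε i) (ε j)]
    push_cast
    linear_combination (-(sgn K ((j : ℕ) : ZMod 2) * sgn K (ε j * ∑ l ∈ Finset.Ioo i' j, ε l) *
      f (bracket (K := K) (x i') (x j)) * ψ (j.removeNth (Function.update x i' z)))) * hsq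
  · rw [hf _ _ _ _ (hx i') (hx j) he]
    simp

/-- After super-alternization all summands of `dψ` agree. -/
theorem superAlt_pairSummand {k : ℕ} (f : g →ₗ[K] K) {z : g} (hz : z ∈ part K 0)
    (hf : ∀ a b (x y : g), x ∈ part K a → y ∈ part K b → a ≠ b → f (bracket (K := K) x y) = 0)
    {ψ : MultilinearMap K (fun _ : Fin (k + 1) => g) K} (hψ : ψ ∈ cochains K g K (k + 1))
    {ε : Fin (k + 2) → ZMod 2} {x : Fin (k + 2) → g} (hx : ∀ l, x l ∈ part K (ε l))
    {i j : Fin (k + 2)} (hij : i < j) :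
    superAlt (K := K) (pairSummand f z ψ i j) ε x =
      superAlt (K := K) (pairSummand f z ψ 0 1) ε x := by
  obtain ⟨i, hi⟩ := i
  obtain ⟨j, hj⟩ := j
  rw [Fin.mk_lt_mk] at hij
  induction i with
  | zero =>
    induction j, Nat.succ_le_of_lt hij using Nat.le_induction with
    | base => rfl
    | succ j hj1 ih =>
      rw [← ih (by omega) (by omega)]
      exact superAlt_pairSummand_succ_right f z ψ (j := ⟨j, by omega⟩)
        (by rw [Fin.mk_lt_mk]; omega) rfl hx
  | succ i ih =>
    rw [← ih (by omega) (by omega)]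
    exact superAlt_pairSummand_succ_left f hz hf hψ (i := ⟨i, by omega⟩) rfl
      (by rw [Fin.mk_lt_mk]; omega) hx

/-- The sum of all summands of `dψ` is, up to super-alternization, a positive multiple of the first
one. Hence the latter vanishes with `dψ`. -/
theorem superAlt_pairSummand_eq_zero [CharZero K] {k : ℕ} {f : g →ₗ[K] K} {z : g}
    (hz : z ∈ part K 0)
    (hf : ∀ a b (x y : g), x ∈ part K a → y ∈ part K b → a ≠ b → f (bracket (K := K) x y) = 0)
    (hfz : ∀ x y : g, bracket (K := K) x y = f (bracket (K := K) x y) • z)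
    {ψ : MultilinearMap K (fun _ : Fin (k + 1) => g) K} (hψ : ψ ∈ cochains K g K (k + 1))
    (hdψ : trivialD K g (k + 1) ψ = 0)
    {ε : Fin (k + 2) → ZMod 2} {x : Fin (k + 2) → g} (hx : ∀ l, x l ∈ part K (ε l)) :
    superAlt (K := K) (pairSummand f z ψ 0 1) ε x = 0 := by
  let s : Finset (Fin (k + 2) × Fin (k + 2)) := Finset.univ.filter fun p => p.1 < p.2
  have hs : (s.card : K) ≠ 0 := by
    refine Nat.cast_ne_zero.2 (Finset.card_pos.2 ⟨(0, 1), ?_⟩).ne'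
    simp [s]
  have h0 : ∀ (ε : Fin (k + 2) → ZMod 2) (x : Fin (k + 2) → g), (∀ l, x l ∈ part K (ε l)) →
      ∑ p ∈ s, pairSummand f z ψ p.1 p.2 ε x = 0 := by
    intro ε x hx
    have h := congrArg (fun φ => φ x) hdψ
    rw [trivialD_apply ψ hx, zero_apply] at h
    rw [← h, Finset.sum_filter, Fintype.sum_prod_type]
    refine Finset.sum_congr rfl fun i _ => Finset.sum_congr rfl fun j _ => ?_
    dsimp only
    split_ifs with hij
    · obtain ⟨m, rfl⟩ := Fin.exists_succAbove_eq hij.ne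
      rw [pairSummand, hfz, Fin.removeNth_update_succAbove, Fin.removeNth_update_succAbove,
        MultilinearMap.map_update_smul, ← hfz]
      rfl
    · rfl
  refine (mul_eq_zero.1 ?_).resolve_left hs
  calc (s.card : K) * superAlt (K := K) (pairSummand f z ψ 0 1) ε x
      = ∑ p ∈ s, superAlt (K := K) (pairSummand f z ψ p.1 p.2) ε x := by
        rw [Finset.sum_congr rfl fun p hp =>
          superAlt_pairSummand f hz hf hψ hx (Finset.mem_filter.1 hp).2]
        rw [Finset.sum_const, nsmul_eq_mul]
    _ = 0 := by
        simp only [superAlt]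
        rw [Finset.sum_comm]
        refine Finset.sum_eq_zero fun σ _ => ?_
        rw [← Finset.smul_sum, h0 (ε ∘ σ) (x ∘ σ) fun l => hx _, smul_zero]

end PairSummand

/-! ### Even arguments of a cochain -/

section EvenArguments

variable {K g M : Type*} [Field K] [AddCommGroup g] [Module K g] [AddCommGroup M] [Module K M]

theorem cochain_eq_zero_of_mem_span {n : ℕ} {φ : MultilinearMap K (fun _ : Fin n => g) M} {z : g}
    (h : ∀ (i : Fin n) (x : Fin n → g), x i = z → φ x = 0) {i : Fin n} {x : Fin n → g}
    (hi : x i ∈ Submodule.span K {z}) : φ x = 0 := by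
  obtain ⟨c, hc⟩ := Submodule.mem_span_singleton.1 hi
  rw [← Function.update_eq_self i x, ← hc, MultilinearMap.map_update_smul,
    h i _ (Function.update_self i z x), smul_zero]

variable [SuperSpace K g]

theorem superAlt_cast {m n : ℕ} (e : n = m) {F : (Fin m → ZMod 2) → (Fin m → g) → M}
    {G : (Fin n → ZMod 2) → (Fin n → g) → M}
    (hFG : ∀ ε x, (∀ i, x i ∈ part K (ε i)) → F ε x = G (ε ∘ Fin.cast e) (x ∘ Fin.cast e))
    {ε : Fin m → ZMod 2} {x : Fin m → g} (hx : ∀ i, x i ∈ part K (ε i)) :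
    superAlt (K := K) F ε x = superAlt (K := K) G (ε ∘ Fin.cast e) (x ∘ Fin.cast e) := by
  subst e
  refine Finset.sum_congr rfl fun σ _ => ?_
  rw [hFG (ε ∘ σ) (x ∘ σ) fun i => hx (σ i)]
  rfl

/-- Exchanging an even argument with an adjacent one, homogeneous or not, changes the sign. -/
theorem cochain_swap_even {n : ℕ} {φ : MultilinearMap K (fun _ : Fin n => g) M}
    (hφ : φ ∈ cochains K g M n) {i j : Fin n} (hij : (i : ℕ) + 1 = j) {x : Fin n → g}
    (hj : x j ∈ part K 0) : φ (x ∘ Equiv.swap i j) = -φ x := by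
  have hne : i ≠ j := by rintro rfl; omega
  have hx : x = Function.update x i (∑ a : ZMod 2, proj K a (x i)) := by
    rw [sum_proj, Function.update_eq_self]
  have hswap : ∀ v : g, Function.update x i v ∘ Equiv.swap i j =
      Function.update (x ∘ Equiv.swap i j) j v := by
    intro v
    rw [Equiv.comp_swap_eq_update, Equiv.comp_swap_eq_update]
    funext l
    rcases eq_or_ne l i with rfl | hi
    · simp [hne, hne.symm]
    · rcases eq_or_ne l j with rfl | hj'
      · simp [hi]
      · simp [hi, hj']
  rw [hx, hswap, MultilinearMap.map_update_sum, MultilinearMap.map_update_sum,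
    ← Finset.sum_neg_distrib]
  refine Finset.sum_congr rfl fun a _ => ?_
  rw [← hswap]
  have := hφ i j hij a 0 (Function.update x i (proj K a (x i)))
    (by simpa using proj_mem K a (x i)) (by simpa [hne.symm] using hj)
  rwa [mul_zero, sgn_zero, one_smul] at this

/-- A cochain that vanishes whenever its first argument is the even element `z` vanishes whenever
one of its arguments is `z`. -/
theorem cochain_eq_zero_of_forall_zero {n : ℕ} {φ : MultilinearMap K (fun _ : Fin (n + 1) => g) M}
    (hφ : φ ∈ cochains K g M (n + 1)) {z : g} (hz : z ∈ part K 0)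
    (h0 : ∀ x : Fin (n + 1) → g, x 0 = z → φ x = 0) (i : Fin (n + 1)) (x : Fin (n + 1) → g)
    (hi : x i = z) : φ x = 0 := by
  obtain ⟨i, hin⟩ := i
  induction i generalizing x with
  | zero => exact h0 x hi
  | succ i ih =>
    have h := cochain_swap_even hφ (i := ⟨i, by omega⟩) (j := ⟨i + 1, hin⟩) rfl (x := x)
      (by rw [hi]; exact hz)
    rw [ih (x ∘ Equiv.swap ⟨i, by omega⟩ ⟨i + 1, hin⟩) (by omega) (by simpa using hi)] at h
    exact neg_eq_zero.1 h.symm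

theorem curryLeft_mem_cochains {n : ℕ} {φ : MultilinearMap K (fun _ : Fin (n + 1) => g) M}
    (hφ : φ ∈ cochains K g M (n + 1)) (z : g) : φ.curryLeft z ∈ cochains K g M n := by
  intro i j hij a b x hi hj
  rw [MultilinearMap.curryLeft_apply, MultilinearMap.curryLeft_apply,
    ← hφ i.succ j.succ (by simp [← hij]) a b (Fin.cons z x) (by simpa using hi) (by simpa using hj)]
  congr 1
  funext l
  refine Fin.cases ?_ (fun l => ?_) l
  · rw [Equiv.swap_apply_of_ne_of_ne (Fin.succ_ne_zero i).symm (Fin.succ_ne_zero j).symm]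
    rfl
  · rw [← Function.Injective.map_swap (Fin.succ_injective n)]
    rfl

end EvenArguments

/-! ### Products with the two-form of the bracket -/

section Cocycles

variable {K g : Type*} [Field K] [AddCommGroup g] [Module K g] [LieSuperalgebra K g]

theorem oneForm_differential_mem_complementForms (hg : IsStepNilpotent K g 2)
    (f : Module.Dual K g) : trivialD K g 1 (oneForm f) ∈ complementForms K g 2 := by
  refine ⟨mem_cochains_of_homogeneous fun i j hij ε x hx => ?_, fun x i hi => ?_⟩
  · have hi : i = 0 := by omega
    have hj : j = 1 := by omega
    subst hi hj
    rw [trivialD_oneForm_apply, trivialD_oneForm_apply]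
    simp only [Function.comp_apply, Equiv.swap_apply_left, Equiv.swap_apply_right]
    rw [bracket_skew (ε 1) (ε 0) _ _ (hx 1) (hx 0), mul_comm (ε 1)]
    simp
  · rw [trivialD_oneForm_apply]
    fin_cases i
    · have := hg.bracket_derived_left (x 1) hi
      simp_all
    · have := hg.bracket_derived_right (x 0) hi
      simp_all

theorem wedge_curryLeft_eq_zero [CharZero K] {k : ℕ} {f : Module.Dual K g} {z : g}
    (hz : z ∈ part K 0)
    (hf : ∀ a b (x y : g), x ∈ part K a → y ∈ part K b → a ≠ b → f (bracket (K := K) x y) = 0)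
    (hfz : ∀ x y : g, bracket (K := K) x y = f (bracket (K := K) x y) • z)
    {ψ : MultilinearMap K (fun _ : Fin (k + 1) => g) K} (hψ : ψ ∈ cochains K g K (k + 1))
    (hdψ : trivialD K g (k + 1) ψ = 0) :
    wedge (trivialD K g 1 (oneForm f)) (ψ.curryLeft z) = 0 := by
  refine ext_homogeneous fun ε x hx => ?_
  have e : k + 2 = 1 + 1 + k := by omega
  rw [wedge, cup_apply _ _ _ hx, superAlt_cast e (G := pairSummand f z ψ 0 1) ?_ hx,
    superAlt_pairSummand_eq_zero (ε := ε ∘ Fin.cast e) (x := x ∘ Fin.cast e) hz hf hfz hψ hdψ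
      fun l => hx _, smul_zero, zero_apply]
  intro ε x hx
  have hIoo : Finset.Ioo (0 : Fin (k + 2)) 1 = ∅ := by
    ext l
    simp only [Finset.mem_Ioo, Fin.lt_def, Fin.val_zero, Fin.val_one, Finset.notMem_empty,
      iff_false]
    omega
  have h0 : Fin.cast e 0 = Fin.castAdd k (0 : Fin (1 + 1)) := by ext; simp
  have h1 : Fin.cast e 1 = Fin.castAdd k (1 : Fin (1 + 1)) := by ext; simp
  have harg : (1 : Fin (k + 2)).removeNth (Function.update (x ∘ Fin.cast e) 0 z) =
      Fin.cons z (x ∘ Fin.natAdd (1 + 1)) := by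
    funext l
    refine Fin.cases ?_ (fun l => ?_) l
    · simp [Fin.removeNth]
    · have h2 : (1 : Fin (k + 2)).succAbove l.succ = l.succ.succ :=
        Fin.succAbove_of_le_castSucc _ _ (by rw [Fin.le_def]; simp)
      have h3 : Fin.cast e l.succ.succ = Fin.natAdd (1 + 1) l := by ext; simp; omega
      rw [Fin.removeNth, h2, Function.update_of_ne (Fin.succ_ne_zero _), Fin.cons_succ,
        Function.comp_apply, Function.comp_apply, h3]
  rw [cupSummand_mul_apply _ _ hx, pairSummand, harg, hIoo, trivialD_oneForm_apply,
    MultilinearMap.curryLeft_apply, Fin.sum_univ_two]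
  simp only [Function.comp_apply, h0, h1, Finset.sum_empty, mul_zero, add_zero, Fin.val_one,
    Nat.cast_one, sgn_one]
  rcases eq_or_ne (ε (Fin.castAdd k (0 : Fin (1 + 1)))) (ε (Fin.castAdd k (1 : Fin (1 + 1))))
    with he | he
  · rw [he, CharTwo.add_self_eq_zero, zero_mul, sgn_zero]
    ring
  · rw [hf _ _ _ _ (hx _) (hx _) he]
    simp

/-- The square of an odd `2`-form `df` vanishes. -/
theorem wedge_self_eq_zero [CharZero K] {f : Module.Dual K g}
    (hf : ∀ a (x y : g), x ∈ part K a → y ∈ part K a → f (bracket (K := K) x y) = 0) :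
    wedge (trivialD K g 1 (oneForm f)) (trivialD K g 1 (oneForm f)) = 0 := by
  refine ext_homogeneous fun ε x hx => ?_
  set om := trivialD K g 1 (oneForm f) with hom
  -- Exchanging the two factors is an even permutation, with Koszul sign `-1`.
  let τ : Equiv.Perm (Fin 4) := Equiv.swap 0 2 * Equiv.swap 1 3
  have hτs : Equiv.Perm.sign τ = 1 := by decide
  have hτ0 : τ 0 = 2 := by decide
  have hτ1 : τ 1 = 3 := by decide
  have hτ2 : τ 2 = 0 := by decide
  have hτ3 : τ 3 = 1 := by decide
  have hτk : ∀ ε : Fin 4 → ZMod 2,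
      koszulSign K ε τ = sgn K ((ε 0 + ε 1) * (ε 2 + ε 3)) := by
    intro ε
    simp only [koszulSign, Fin.prod_univ_four, hτ0, hτ1, hτ2, hτ3, add_mul, mul_add, sgn_add]
    simp
    simp only [mul_comm (ε 2), mul_comm (ε 3)]
  have hsum : ∀ (ε : Fin 4 → ZMod 2) (x : Fin 4 → g), (∀ i, x i ∈ part K (ε i)) →
      cupSummand (q := 2) (p := 2) (LinearMap.mul K K) om om ε x =
        sgn K ((ε 0 + ε 1) * (ε 2 + ε 3)) *
          (f (bracket (K := K) (x 0) (x 1)) * f (bracket (K := K) (x 2) (x 3))) := by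
    intro ε x hx
    rw [cupSummand_mul_apply (q := 2) (p := 2) _ _ hx, hom, trivialD_oneForm_apply,
      trivialD_oneForm_apply, Fin.sum_univ_two, Fin.sum_univ_two, neg_mul_neg]
    rfl
  have key : superAlt (K := K) (cupSummand (q := 2) (p := 2) (LinearMap.mul K K) om om) ε x =
      superAlt (K := K)
        (fun ε x => -cupSummand (q := 2) (p := 2) (LinearMap.mul K K) om om ε x) ε x := by
    refine superAlt_congr_perm (n := 4) τ (fun ε x hx => ?_) hx
    rw [hsum ε x hx, hsum (ε ∘ τ) (x ∘ τ) fun i => hx _, hτs, hτk]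
    simp only [Function.comp_apply, hτ0, hτ1, hτ2, hτ3]
    rcases eq_or_ne (ε 0) (ε 1) with h | h
    · rw [hf _ _ _ (hx 0) (h ▸ hx 1)]
      simp
    rcases eq_or_ne (ε 2) (ε 3) with h' | h'
    · rw [hf _ _ _ (hx 2) (h' ▸ hx 3)]
      simp
    have h2 : ∀ a b : ZMod 2, a ≠ b → a + b = 1 := by decide
    rw [h2 _ _ h, h2 _ _ h', one_mul, sgn_one]
    simp
    ring
  have hneg : superAlt (K := K)
      (fun ε x => -cupSummand (q := 2) (p := 2) (LinearMap.mul K K) om om ε x) ε x =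
      -superAlt (K := K) (cupSummand (q := 2) (p := 2) (LinearMap.mul K K) om om) ε x := by
    simp only [superAlt, smul_neg, Finset.sum_neg_distrib]
  rw [hneg, self_eq_neg] at key
  rw [wedge, cup_apply _ _ _ hx, zero_apply]
  exact (congrArg _ key).trans (smul_zero _)

end Cocycles

/-! ### Scalar cocycles -/

section Vanishing

variable {K g : Type*} [Field K] [CharZero K] [AddCommGroup g] [Module K g] [LieSuperalgebra K g]

/-- The conclusion drawn from the injectivity of `w ↦ df ∧ w`: scalar cocycles are forms on
`g / [g, g]`. -/
theorem scalar_cocycle_eq_zero {f : Module.Dual K g} {z : g} (hz : z ∈ part K 0)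
    (hspan : derived K g = Submodule.span K {z})
    (hf : ∀ a b (x y : g), x ∈ part K a → y ∈ part K b → a ≠ b → f (bracket (K := K) x y) = 0)
    (hfz : ∀ x y : g, bracket (K := K) x y = f (bracket (K := K) x y) • z)
    (hinj : ∀ k : ℕ, 1 ≤ k → ∀ w ∈ complementForms K g k,
      wedge (trivialD K g 1 (oneForm f)) w = 0 → w = 0)
    {n : ℕ} {ψ : MultilinearMap K (fun _ : Fin n => g) K} (hψ : ψ ∈ cochains K g K n)
    (hdψ : trivialD K g n ψ = 0) {i : Fin n} {x : Fin n → g} (hi : x i ∈ derived K g) :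
    ψ x = 0 := by
  rcases n with - | n
  · exact i.elim0
  rw [hspan] at hi
  refine cochain_eq_zero_of_mem_span (z := z)
    (cochain_eq_zero_of_forall_zero hψ hz fun y hy => ?_) hi
  rcases n with - | n
  · -- In degree one `dψ = 0` says directly that the linear form `ψ` vanishes on `[g, g]`.
    let lam : Module.Dual K g := (MultilinearMap.ofSubsingleton K g K (0 : Fin 1)).symm ψ
    have hlam : oneForm lam = ψ :=
      (MultilinearMap.ofSubsingleton K g K (0 : Fin 1)).apply_symm_apply ψ
    have hle : derived K g ≤ LinearMap.ker lam := by
      refine Submodule.span_le.2 ?_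
      rintro _ ⟨a, b, rfl⟩
      have h := trivialD_oneForm_apply lam ![a, b]
      rw [hlam] at h
      exact neg_eq_zero.1 (h.symm.trans (congrArg (fun φ => φ ![a, b]) hdψ))
    rw [← hlam]
    change lam (y 0) = 0
    rw [hy]
    exact hle (hspan ▸ Submodule.mem_span_singleton_self z)
  · have hb := curryLeft_mem_cochains hψ z
    have hbz : ∀ (i : Fin (n + 1)) (v : Fin (n + 1) → g), v i = z → ψ.curryLeft z v = 0 := by
      refine cochain_eq_zero_of_forall_zero hb hz fun v hv => ?_
      rw [MultilinearMap.curryLeft_apply]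
      -- The first two arguments are both the even element `z`.
      have h := cochain_swap_even hψ (i := 0) (j := 1) rfl (x := Fin.cons z v)
        (by change v 0 ∈ _; rw [hv]; exact hz)
      have hx : (Fin.cons z v : Fin (n + 2) → g) ∘ Equiv.swap 0 1 = Fin.cons z v := by
        rw [Equiv.comp_swap_eq_update]
        funext l
        rcases eq_or_ne l 0 with rfl | h0
        · simp [← hv]
        · rcases eq_or_ne l 1 with rfl | h1
          · simp [← hv]
          · simp [h0, h1]
      rw [hx] at h
      exact self_eq_neg.1 h
    have hzero := hinj (n + 1) (by omega) (ψ.curryLeft z)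
      ⟨hb, fun v i hv => cochain_eq_zero_of_mem_span hbz (i := i) (hspan ▸ hv)⟩
      (wedge_curryLeft_eq_zero hz hf hfz hψ hdψ)
    rw [← Fin.cons_self_tail y, hy, ← MultilinearMap.curryLeft_apply, hzero, zero_apply]

end Vanishing

/-! ### Cup products of adjoint cocycles -/

section Products

variable {K g : Type*} [Field K] [AddCommGroup g] [Module K g] [LieSuperalgebra K g]

theorem compMultilinearMap_mem_cochains {n : ℕ} {φ : MultilinearMap K (fun _ : Fin n => g) g}
    (hφ : φ ∈ cochains K g g n) (lam : g →ₗ[K] K) :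
    lam.compMultilinearMap φ ∈ cochains K g K n := by
  intro i j hij a b x hi hj
  simp only [LinearMap.compMultilinearMap_apply]
  rw [hφ i j hij a b x hi hj, map_neg, map_smul]

/-- The subspace `[g, g]` is graded if it is spanned by a homogeneous element. -/
theorem proj_mem_derived {a : ZMod 2} {z : g} (hz : z ∈ part K a)
    (hspan : derived K g = Submodule.span K {z}) (s : ZMod 2) {c : g} (hc : c ∈ derived K g) :
    proj K s c ∈ derived K g := by
  obtain ⟨r, rfl⟩ := Submodule.mem_span_singleton.1 (hspan ▸ hc)
  rw [map_smul]
  refine Submodule.smul_mem _ _ ?_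
  by_cases h : s = a
  · rw [h, proj_of_mem hz, hspan]
    exact Submodule.mem_span_singleton_self z
  · rw [proj_of_mem_of_ne h hz]
    exact Submodule.zero_mem _

/-- The cochain `φ` induces a form on `g / [g, g]` with values in `g / [g, g]`. -/
def DescendsModDerived {n : ℕ} (φ : MultilinearMap K (fun _ : Fin n => g) g) : Prop :=
  ∀ (i : Fin n) (x : Fin n → g), x i ∈ derived K g → φ x ∈ derived K g

theorem DescendsModDerived.parityPart {a : ZMod 2} {z : g} (hz : z ∈ part K a)
    (hspan : derived K g = Submodule.span K {z}) {n : ℕ}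
    {φ : MultilinearMap K (fun _ : Fin n => g) g} (hφ : DescendsModDerived φ) (t : ZMod 2) :
    DescendsModDerived (parityPart t φ) := by
  intro i x hi
  simp only [LieSuperalgebra.parityPart, ofHomogeneous, sum_apply,
    MultilinearMap.compLinearMap_apply, LinearMap.compMultilinearMap_apply]
  exact Submodule.sum_mem _ fun ε _ => proj_mem_derived hz hspan _
    (hφ i _ (proj_mem_derived hz hspan _ hi))

theorem IsStepNilpotent.cup_eq_zero (hg : IsStepNilpotent K g 2) {a : ZMod 2} {z : g}
    (hz : z ∈ part K a) (hspan : derived K g = Submodule.span K {z}) {q p : ℕ}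
    {f : MultilinearMap K (fun _ : Fin q => g) g} {h : MultilinearMap K (fun _ : Fin p => g) g}
    (hf : DescendsModDerived f) (hh : DescendsModDerived h) {i : Fin (q + p)}
    {x : Fin (q + p) → g} (hi : x i ∈ derived K g) : cup (bracket (K := K)) f h x = 0 := by
  have hjux : ∀ (t : ZMod 2) (y : Fin (q + p) → g) (l : Fin (q + p)), y l ∈ derived K g →
      juxtapose (bracket (K := K)) f (LieSuperalgebra.parityPart t h) y = 0 := by
    intro t y l
    rw [juxtapose_apply]
    refine Fin.addCases (fun l hl => ?_) (fun l hl => ?_) l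
    · exact hg.bracket_derived_left _ (hf l _ hl)
    · exact hg.bracket_derived_right _ (hh.parityPart hz hspan t l _ hl)
  simp only [cup, ofHomogeneous, sum_apply, MultilinearMap.compLinearMap_apply, smul_apply,
    MultilinearMap.domDomCongr_apply]
  refine Finset.sum_eq_zero fun ε _ => ?_
  rw [Finset.sum_eq_zero, smul_zero]
  intro t _
  refine Finset.sum_eq_zero fun σ _ => ?_
  rw [hjux t _ (σ.symm i), smul_zero]
  rw [Equiv.apply_symm_apply]
  exact proj_mem_derived hz hspan _ hi

theorem cup_mem_derived {q p : ℕ} (f : MultilinearMap K (fun _ : Fin q => g) g)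
    (h : MultilinearMap K (fun _ : Fin p => g) g) (x : Fin (q + p) → g) :
    cup (bracket (K := K)) f h x ∈ derived K g := by
  simp only [cup, ofHomogeneous, sum_apply, MultilinearMap.compLinearMap_apply, smul_apply,
    MultilinearMap.domDomCongr_apply, juxtapose_apply]
  exact Submodule.sum_mem _ fun ε _ => Submodule.smul_mem _ _ <| Submodule.sum_mem _ fun t _ =>
    Submodule.sum_mem _ fun σ _ => Submodule.smul_mem _ _ (bracket_mem_derived _ _)

/-- In degree zero the cup product is the bracket, and cocycles are central. -/
theorem cup_zero_zero_eq_zero {f h : MultilinearMap K (fun _ : Fin 0 => g) g}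
    (hf : adjointD K g 0 f = 0) : cup (bracket (K := K)) f h = 0 := by
  have hcentral : ∀ y : g, bracket (K := K) (f 0) y = 0 := by
    intro y
    have := congrArg (fun φ => φ (fun _ => y)) hf
    simp only [adjointD_zero_apply] at this
    exact neg_eq_zero.1 this
  ext x
  rw [cup_apply (ε := 0) _ _ _ fun i => i.elim0]
  simp only [superAlt, cupSummand]
  rw [Finset.sum_eq_zero, smul_zero, zero_apply]
  intro σ _
  rw [Finset.sum_eq_zero, smul_zero]
  intro t _
  rw [Subsingleton.elim ((x ∘ σ) ∘ Fin.castAdd 0) 0, hcentral, smul_zero]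

end Products

end LieSuperalgebra

open LieSuperalgebra SuperSpace in
theorem mainTheorem3 {K g : Type*} [Field K] [IsAlgClosed K] [CharZero K]
    [AddCommGroup g] [Module K g] [LieSuperalgebra K g]
    (hg : LieSuperalgebra.IsStepNilpotent K g 2)
    (V : Submodule K g) (hV : IsCompl (LieSuperalgebra.derived K g) V)
    (h1 : ∀ k : ℕ, 1 ≤ k →
      LieSuperalgebra.derivedTensorForms K g k ≤ LieSuperalgebra.coboundaries K g k)
    (h2 : ∀ k : ℕ, 1 ≤ k → ∀ f ∈ V.dualAnnihilator, ∀ w ∈ LieSuperalgebra.complementForms K g k,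
      LieSuperalgebra.wedge
        (LieSuperalgebra.trivialD K g 1 (LieSuperalgebra.oneForm f)) w = 0 → f = 0 ∨ w = 0) :
    LieSuperalgebra.CupProductTrivial K g := by
  obtain ⟨a, z, hza, hz0, hspan⟩ := hg.exists_derived_eq_span (h1 1 le_rfl)
  have hzd : z ∈ derived K g := hspan ▸ Submodule.mem_span_singleton_self z
  -- `f` is the linear form with `f z = 1` that vanishes on `V`.
  obtain ⟨f, hfV, hfz⟩ : ∃ f ∈ V.dualAnnihilator, f z = 1 := by
    have hzV : z ∉ V := fun h => hz0 (Submodule.disjoint_def.1 hV.disjoint z hzd h)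
    obtain ⟨f, hfz, hf⟩ := Submodule.exists_le_ker_of_notMem hzV
    refine ⟨(f z)⁻¹ • f, ?_, by simp [hfz]⟩
    rw [Submodule.mem_dualAnnihilator]
    intro v hv
    rw [LinearMap.smul_apply, hf hv, smul_zero]
  have hbr : ∀ x y : g, bracket (K := K) x y = f (bracket (K := K) x y) • z := by
    intro x y
    have hxy := bracket_mem_derived (K := K) x y
    rw [hspan] at hxy
    obtain ⟨c, hc⟩ := Submodule.mem_span_singleton.1 hxy
    rw [← hc, map_smul, hfz, smul_eq_mul, mul_one]
  have hf0 : f ≠ 0 := by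
    rintro rfl
    simp at hfz
  have hinj : ∀ k : ℕ, 1 ≤ k → ∀ w ∈ complementForms K g k,
      wedge (trivialD K g 1 (oneForm f)) w = 0 → w = 0 := fun k hk w hw hfw =>
    (h2 k hk f hfV w hw hfw).resolve_left hf0
  -- `f` vanishes on the brackets whose parity is not that of `z`.
  have hpar : ∀ s t (x y : g), x ∈ part K s → y ∈ part K t → s + t ≠ a →
      f (bracket (K := K) x y) = 0 := by
    intro s t x y hx hy hst
    have h := proj_of_mem (bracket_mem s t x y hx hy)
    rw [hbr, map_smul, proj_of_mem_of_ne hst hza, smul_zero] at h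
    exact (smul_eq_zero.1 h.symm).resolve_right hz0
  have ha : a = 0 := by
    by_contra ha
    -- For odd `z` the form `df` is nonzero of square zero.
    have hsq := wedge_self_eq_zero (f := f) fun s x y hx hy =>
      hpar s s x y hx hy (by rw [CharTwo.add_self_eq_zero]; exact Ne.symm ha)
    have hdf := hinj 2 (by norm_num) _ (oneForm_differential_mem_complementForms hg f) hsq
    have hle : derived K g ≤ LinearMap.ker f := by
      refine Submodule.span_le.2 ?_
      rintro _ ⟨x, y, rfl⟩
      have h := trivialD_oneForm_apply f ![x, y]
      rw [hdf, zero_apply] at h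
      exact neg_eq_zero.1 h.symm
    exact one_ne_zero (hfz.symm.trans (hle hzd))
  subst ha
  have hcoc : ∀ (n : ℕ), ∀ φ ∈ cocycles K g n, DescendsModDerived φ := by
    intro n φ hφ i x hi
    by_contra hx
    -- A linear form that kills `[g, g]` but not `φ x` turns `φ` into a scalar cocycle.
    obtain ⟨lam, hlamx, hlam⟩ := Submodule.exists_le_ker_of_notMem hx
    refine hlamx (scalar_cocycle_eq_zero hza hspan (fun s t x y hx hy hst =>
      hpar s t x y hx hy fun h => hst (CharTwo.add_eq_zero.1 h)) hbr hinj
      (compMultilinearMap_mem_cochains hφ.1 lam) ?_ hi)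
    rw [trivialD_compMultilinearMap fun x y => hlam (bracket_mem_derived x y),
      LinearMap.mem_ker.1 hφ.2]
    ext x
    simp
  intro q p φ hφ χ hχ
  rcases Nat.eq_zero_or_pos (q + p) with h0 | hpos
  · obtain ⟨rfl, rfl⟩ : q = 0 ∧ p = 0 := by omega
    rw [cup_zero_zero_eq_zero hφ.2]
    exact Submodule.zero_mem _
  · -- The product is `w ⊗ z`, where the coefficient `w` is obtained by applying `f`.
    refine h1 (q + p) hpos (Submodule.subset_span
      ⟨z, hzd, f.compMultilinearMap (cup (bracket (K := K)) φ χ), ⟨?_, ?_⟩, ?_⟩)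
    · exact compMultilinearMap_mem_cochains (cup_mem_cochains _ _ _) f
    · intro x i hi
      rw [LinearMap.compMultilinearMap_apply,
        hg.cup_eq_zero hza hspan (hcoc q φ hφ) (hcoc p χ hχ) hi, map_zero]
    · ext x
      obtain ⟨c, hc⟩ := Submodule.mem_span_singleton.1 (hspan ▸ cup_mem_derived φ χ x)
      rw [MultilinearMap.smulRight_apply, LinearMap.compMultilinearMap_apply, ← hc, map_smul, hfz,
        smul_eq_mul, mul_one]
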